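/- **Setting.** Let $\mathcal X$ be a finite-dimensional real normed space with norm $\|\cdot\|$, dual space $\mathcal X^*$ with dual norm $\|\cdot\|_*$, and pairing $\langle\cdot,\cdot\rangle$. Let $K\subset\mathcal X$ be nonempty, closed and convex, let $g:K\to(-\infty,+\infty]$ be proper, convex and lower semicontinuous with $\operatorname{dom} g=\{x\in K: g(x)<+\infty\}$, and let $F:\operatorname{dom} g\to\mathcal X^*$. Let $S_1$ be the set of solutions of the variational inequality: $x^*\in\operatorname{dom}g$ with $$\langle F(x^*),y-x^*\rangle+g(y)-g(x^*)\ge 0\quad\text{for all }y\in K .$$ Let $f:\mathcal X\to(-\infty,+\infty]$ be proper, convex and lower semicontinuous with $\operatorname{dom}g\subset\operatorname{dom}f$, differentiable at each point of $\operatorname{dom}\partial f=\{y\in \operatorname{dom} f:\partial f(y)\ne\emptyset\}$ with $\nabla f$ continuous there, and 1-strongly convex: $f(x)\ge f(y)+\langle\nabla f(y),x-y\rangle+\frac12\|x-y\|^2$ for $x\in\operatorname{dom}f$, $y\in\operatorname{dom}\partial f$. Put $D(x,y)=f(x)-f(y)-\langle\nabla f(y),x-y\rangle$. **Assumptions.**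 1. $S_1\cap\operatorname{dom}\partial f\neq\emptyset$. (If $\nabla f$ exists at every point of $\operatorname{dom} g$, this just says $S_1\ne\emptyset$.) 2. $F$ is monotone on $\operatorname{dom}g$: $\langle F(x)-F(y),x-y\rangle\ge0$. 3. $F$ has a stochastic oracle that is variable $\bar L$-Lipschitz in mean ($\bar L\ge 0$): there are maps $F_1,\dots,F_M:\operatorname{dom} g\to\mathcal X^*$ and, for all $x,y\in\operatorname{dom}g$, a probability distribution $Q_{x,y}$ on $\{1,\dots,M\}$ such that $\mathbb E_{\xi\sim Q_{x,y}}[F_\xi(z)]=F(z)$ for all $z\in\operatorname{dom}g$ and $\mathbb E_{\xi\sim Q_{x,y}}\big[\|F_\xi(x)-F_\xi(y)\|_*^2\big]\le\bar L^2\|x-y\|^2$. Every $F_\xi$ is continuous on $\operatorname{dom} g$. 4. $F$ is $L$-Lipschitz on $\operatorname{dom}g$ ($L\ge0$): $\|F(x)-F(y)\|_*\le L\|x-y\|$. **Algorithm.** Let $b\in\{1,\dots,M\}$ and $\alpha>0$, and let $x_0=x_{-1}=w_0=w_{-1}\in\operatorname{dom}g\cap\operatorname{dom}\partial f$. For $s=0,1,2,\dots$: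 conditionally on the past (which includes $x_s$, $w_s$), draw $\xi^s_1,\dots,\xi^s_b$ independently from $Q_{x_s,w_{s-1}}$; put $$\bar x_s=(\nabla f)^{-1}\big(\gamma\nabla f(x_s)+(1-\gamma)\nabla f(x_{s-1})\big),\qquad \Delta^s=\frac1b\sum_{j=1}^b\big(F(w_s)+F_{\xi^s_j}(x_s)-F_{\xi^s_j}(w_{s-1})\big),$$ $$x_{s+1}=\operatorname*{arg\,min}_{x\in K}\{\alpha g(x)+\alpha\langle\Delta^s,x\rangle+D(x,\bar x_s)\};$$ and, by a coin toss independent of the past and of $\xi^s_1,\dots,\xi^s_b$, put $w_{s+1}=x_{s+1}$ with probability $p$ and $w_{s+1}=x_s$ with probability $1-p$. **Theorem.** Suppose $0<p<1$, $p<\gamma<1-\bar L^2(1-p)$, $0<\alpha\le\min\left\{\frac{\gamma-p}{1-p},\frac{1-\gamma}{L^2(1-p)}\right\}$ and $\alpha<\frac{1-\gamma}{\bar L^2(1-p)}$ (a quotient with denominator $0$ being read as $+\infty$). Then, almost surely, the sequence $(x_s)$ converges to a point of $S_1$. -/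

import Mathlib

open Filter Topology MeasureTheory ProbabilityTheory

namespace BregmanVI

noncomputable section

variable {X : Type*} [NormedAddCommGroup X] [NormedSpace ℝ X]

/-- The effective domain `{x ∈ S : φ x < +∞}` of an extended-real function considered on `S`. -/
def effDomain (S : Set X) (φ : X → EReal) : Set X := {x | x ∈ S ∧ φ x < ⊤}

/-- `φ : S → (-∞, +∞]` is proper, convex and lower semicontinuous. For a function that never takes
the value `-∞`, convexity means that the domain is convex and that the finite values are convex
on it. -/
structure IsProperConvexLSC (S : Set X) (φ : X → EReal) : Prop where
  nonempty : (effDomain S φ).Nonempty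
  ne_bot : ∀ x ∈ S, φ x ≠ ⊥
  convexOn : ConvexOn ℝ (effDomain S φ) (fun x => (φ x).toReal)
  lsc : LowerSemicontinuousOn φ S

/-- The convex subdifferential of `f : X → (-∞, +∞]` at `x`, a set of continuous linear
functionals. -/
def subdifferential (f : X → EReal) (x : X) : Set (StrongDual ℝ X) :=
  {v | ∀ y, f x + ((v (y - x) : ℝ) : EReal) ≤ f y}

/-- `dom ∂f`: the points of `dom f` at which `f` has a subgradient. -/
def domSubdiff (f : X → EReal) : Set X :=
  {x | x ∈ effDomain Set.univ f ∧ (subdifferential f x).Nonempty}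

/-- The gradient of (the finite part of) `f`, an element of the dual space. -/
def grad (f : X → EReal) (y : X) : StrongDual ℝ X :=
  fderiv ℝ (fun z => (f z).toReal) y

/-- The Bregman distance `D(x, y) = f x - f y - ⟨∇f y, x - y⟩`, meant for `x ∈ dom f` and
`y ∈ dom ∂f`. -/
def bregman (f : X → EReal) (x y : X) : ℝ :=
  (f x).toReal - (f y).toReal - grad f y (x - y)

/-- `f` is a distance generating function for a problem with domain `G = dom g`: it is proper,
convex, lower semicontinuous, finite on `G`, differentiable on `dom ∂f`, and `1`-strongly convex
with respect to the norm of `X`. -/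
structure IsDistanceGenerating (G : Set X) (f : X → EReal) : Prop where
  proper : IsProperConvexLSC Set.univ f
  subset : G ⊆ effDomain Set.univ f
  /- `f` is finite near `y` and differentiable at `y` -/
  differentiable : ∀ y ∈ domSubdiff f, y ∈ interior (effDomain Set.univ f) ∧
    DifferentiableAt ℝ (fun z => (f z).toReal) y
  strongly_convex : ∀ x ∈ effDomain Set.univ f, ∀ y ∈ domSubdiff f,
    (f y).toReal + grad f y (x - y) + 1 / 2 * ‖x - y‖ ^ 2 ≤ (f x).toReal

/-- The solutions of the variational inequality: points `x` of `dom g` with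
`⟨F x, y - x⟩ + g y - g x ≥ 0` for all `y ∈ K`. -/
def solutionSet (K : Set X) (g : X → EReal) (F : X → StrongDual ℝ X) : Set X :=
  {x | x ∈ effDomain K g ∧ ∀ y ∈ K, g x ≤ ((F x (y - x) : ℝ) : EReal) + g y}

/-- `F` is monotone on `G`. -/
def IsMonotoneOn (G : Set X) (F : X → StrongDual ℝ X) : Prop :=
  ∀ x ∈ G, ∀ y ∈ G, 0 ≤ (F x - F y) (x - y)

/-- `F` is Lipschitz on `G` with constant `L`, from the norm to the dual norm. -/
def IsLipschitzOn (G : Set X) (F : X → StrongDual ℝ X) (L : ℝ) : Prop :=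
  ∀ x ∈ G, ∀ y ∈ G, ‖F x - F y‖ ≤ L * ‖x - y‖

/-- The family `Fξ` with the sampling distributions `Q x y` is a stochastic oracle of `F` that is
variable Lipschitz in mean on `G` with constant `Lbar`. -/
structure IsVariableLipschitzOracle {M : ℕ} (G : Set X) (F : X → StrongDual ℝ X)
    (Fξ : Fin M → X → StrongDual ℝ X) (Q : X → X → PMF (Fin M)) (Lbar : ℝ) : Prop where
  unbiased : ∀ x ∈ G, ∀ y ∈ G, ∀ z ∈ G, ∑ i, (Q x y i).toReal • Fξ i z = F z
  lipschitz : ∀ x ∈ G, ∀ y ∈ G,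
    ∑ i, (Q x y i).toReal * ‖Fξ i x - Fξ i y‖ ^ 2 ≤ Lbar ^ 2 * ‖x - y‖ ^ 2

/-- The batch estimator `Δ = (1/b) ∑_j (F w + F_{ξ_j} x - F_{ξ_j} w')`, where `ξ_1, …, ξ_b` are the
sampled indices. -/
def batchEstimator {M b : ℕ} (F : X → StrongDual ℝ X) (Fξ : Fin M → X → StrongDual ℝ X)
    (ξ : Fin b → Fin M) (x w w' : X) : StrongDual ℝ X :=
  (1 / (b : ℝ)) • ∑ j, (F w + Fξ (ξ j) x - Fξ (ξ j) w')

/-- `z` is the minimizer over `K` of `α g + ⟨α Δ, ·⟩ + D(·, xbar)`. Outside `dom g` the objective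
is `+∞`, so the minimization is over `dom g ⊆ dom f`, where everything is real. -/
def IsBregmanProx (K : Set X) (g f : X → EReal) (α : ℝ) (Δ : StrongDual ℝ X) (xbar z : X) : Prop :=
  z ∈ effDomain K g ∧
    IsMinOn (fun u => α * (g u).toReal + α * Δ u + bregman f u xbar) (effDomain K g) z

/-- The random sequences `x s`, `w s` are produced by the single-loop variance reduced Bregman
method started at `x₀`, with sampled indices `ξ s : Fin b → Fin M` and coins `coin s` at
iteration `s`. The filtration `ℱ s` carries the information available before iteration `s`.
The conventions `x_{-1} = x_0` and `w_{-1} = w_0` are expressed by the truncated subtraction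
`0 - 1 = 0` of natural numbers. -/
structure IsAlgorithmRun {Ω : Type*} {m : MeasurableSpace Ω} (μ : Measure Ω) (ℱ : Filtration ℕ m)
    {M b : ℕ} (K : Set X) (g f : X → EReal) (F : X → StrongDual ℝ X)
    (Fξ : Fin M → X → StrongDual ℝ X) (Q : X → X → PMF (Fin M)) (p γ α : ℝ) (x₀ : X)
    (ξ : ℕ → Fin b → Ω → Fin M) (coin : ℕ → Ω → Bool) (x w : ℕ → Ω → X) : Prop where
  x_zero : ∀ ω, x 0 ω = x₀
  w_zero : ∀ ω, w 0 ω = x₀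
  measurable_x : ∀ s, StronglyMeasurable[ℱ s] (x s)
  measurable_w : ∀ s, StronglyMeasurable[ℱ s] (w s)
  measurable_ξ : ∀ s j, Measurable[ℱ (s + 1)] (ξ s j)
  measurable_coin : ∀ s, Measurable[ℱ (s + 1)] (coin s)
  /- Given the past, the indices `ξ s j` are drawn independently from `Q (x s) (w (s - 1))`, and
  the coin is an independent Bernoulli variable with success probability `p`. -/
  sampling : ∀ (s : ℕ) (J : Fin b → Fin M) (c : Bool),
    μ⟦{ω | (∀ j, ξ s j ω = J j) ∧ coin s ω = c} | ℱ s⟧ =ᵐ[μ]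
      fun ω => (∏ j, (Q (x s ω) (w (s - 1) ω) (J j)).toReal) * (if c then p else 1 - p)
  /- The inertial point `xbar` is `(∇f)⁻¹ (γ ∇f(x_s) + (1 - γ) ∇f(x_{s-1}))`. -/
  x_succ : ∀ s ω, ∃ xbar ∈ domSubdiff f,
    grad f xbar = γ • grad f (x s ω) + (1 - γ) • grad f (x (s - 1) ω) ∧
    IsBregmanProx K g f α
      (batchEstimator F Fξ (fun j => ξ s j ω) (x s ω) (w s ω) (w (s - 1) ω)) xbar (x (s + 1) ω)
  w_succ : ∀ s ω, w (s + 1) ω = if coin s ω then x (s + 1) ω else x s ω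

end

end BregmanVI

open BregmanVI

namespace BregmanVI

section Step

variable {X : Type*} [NormedAddCommGroup X] [NormedSpace ℝ X]

theorem coe_toReal_of_mem_effDomain {S : Set X} {φ : X → EReal} (h : IsProperConvexLSC S φ) {x : X}
    (hx : x ∈ effDomain S φ) : ((φ x).toReal : EReal) = φ x :=
  EReal.coe_toReal hx.2.ne (h.ne_bot x hx.1)

theorem mem_domSubdiff_of_forall_le {f : X → EReal} (hf : IsProperConvexLSC Set.univ f) {x : X}
    (hx : x ∈ effDomain Set.univ f) (v : StrongDual ℝ X)
    (hv : ∀ y ∈ effDomain Set.univ f, (f x).toReal + v (y - x) ≤ (f y).toReal) :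
    x ∈ domSubdiff f := by
  refine ⟨hx, v, fun y => ?_⟩
  by_cases hy : f y = ⊤
  · rw [hy]; exact le_top
  · have hy' : y ∈ effDomain Set.univ f := ⟨trivial, lt_top_iff_ne_top.2 hy⟩
    rw [← coe_toReal_of_mem_effDomain hf hx, ← coe_toReal_of_mem_effDomain hf hy',
      ← EReal.coe_add, EReal.coe_le_coe_iff]
    exact hv y hy'

/-- A point minimizing `f + φ` over a convex set that meets the interior of `dom f` is a point of
`dom ∂f`. -/
theorem mem_domSubdiff_of_isMinOn_add [FiniteDimensional ℝ X] {f : X → EReal}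
    (hf : IsProperConvexLSC Set.univ f) {C : Set X} {φ : X → ℝ} (hφ : ConvexOn ℝ C φ)
    {a z : X} (haC : a ∈ C) (haf : a ∈ interior (effDomain Set.univ f))
    (hzC : z ∈ C) (hzf : z ∈ effDomain Set.univ f)
    (hmin : ∀ u ∈ C, u ∈ effDomain Set.univ f → (f z).toReal + φ z ≤ (f u).toReal + φ u) :
    z ∈ domSubdiff f := by
  set d := effDomain Set.univ f with hd
  set r : X → ℝ := fun y => (f y).toReal with hr
  have hconv : ConvexOn ℝ d r := hf.convexOn
  have hcont : ContinuousOn r (interior d) := hconv.continuousOn_interior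
  have hconvI : ConvexOn ℝ (interior d) r := hconv.subset interior_subset hconv.1.interior
  let A : Set (X × ℝ) := {y | y.1 ∈ interior d ∧ r y.1 < y.2}
  let B : Set (X × ℝ) := {y | y.1 ∈ C ∧ y.2 ≤ r z + φ z - φ y.1}
  have hAconv : Convex ℝ A := hconvI.convex_strict_epigraph
  have hAopen : IsOpen A := by
    have h1 : IsOpen {y : X × ℝ | y.1 ∈ interior d} := isOpen_interior.preimage continuous_fst
    have h2 : ContinuousOn (fun y : X × ℝ => y.2 - r y.1) {y : X × ℝ | y.1 ∈ interior d} :=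
      continuousOn_snd.sub (hcont.comp continuousOn_fst fun y hy => hy)
    convert h2.isOpen_inter_preimage h1 isOpen_Ioi (t := Set.Ioi 0) using 1
    ext y; simp [A]
  have hBconv : Convex ℝ B := by
    have h : ConcaveOn ℝ C fun y => r z + φ z - φ y :=
      (concaveOn_const (r z + φ z) hφ.1).sub hφ
    exact h.convex_hypograph
  have hdisj : Disjoint A B := by
    rw [Set.disjoint_left]
    rintro ⟨y, t⟩ ⟨hy1, hy2⟩ ⟨hy3, hy4⟩
    have := hmin y hy3 (interior_subset hy1)
    simp only [hr] at hy2 hy4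
    linarith
  obtain ⟨Λ, s, hA, hB⟩ := geometric_hahn_banach_open hAconv hAopen hBconv hdisj
  set κ := Λ (0, 1) with hκ
  set v : StrongDual ℝ X := Λ.comp (ContinuousLinearMap.inl ℝ X ℝ) with hv
  have hΛ : ∀ y t, Λ (y, t) = v y + κ * t := by
    intro y t
    have : (y, t) = (y, (0 : ℝ)) + t • ((0 : X), (1 : ℝ)) := by simp
    rw [this, map_add, map_smul, smul_eq_mul, mul_comm]
    rfl
  have hκneg : κ < 0 := by
    have h1 := hA (a, max (r a) (r z + φ z - φ a) + 1)
      ⟨haf, lt_of_le_of_lt (le_max_left _ _) (lt_add_one _)⟩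
    have h2 := hB (a, r z + φ z - φ a) ⟨haC, le_rfl⟩
    rw [hΛ] at h1 h2
    have h3 := le_max_right (r a) (r z + φ z - φ a)
    nlinarith
  have hzs : s ≤ v z + κ * r z := by
    rw [← hΛ]; exact hB _ ⟨hzC, by simp⟩
  have hint : ∀ y ∈ interior d, v y + κ * r y ≤ s := by
    intro y hy
    refine le_of_forall_pos_lt_add fun ε hε => ?_
    have h1 := hA (y, r y + ε / (-κ)) ⟨hy, by simpa using div_pos hε (neg_pos.2 hκneg)⟩
    rw [hΛ] at h1
    have : κ * (ε / (-κ)) = -ε := by rw [div_neg, mul_neg, mul_div_cancel₀ _ hκneg.ne]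
    linarith
  have hall : ∀ y ∈ d, v y + κ * r y ≤ s := by
    intro y hy
    have hlim : Tendsto (fun t : ℝ => v (y + t • (a - y)) + κ * ((1 - t) * r y + t * r a))
        (𝓝[>] 0) (𝓝 (v (y + (0 : ℝ) • (a - y)) + κ * ((1 - 0) * r y + 0 * r a))) := by
      refine Tendsto.mono_left (Continuous.tendsto ?_ 0) nhdsWithin_le_nhds
      fun_prop
    have := le_of_tendsto hlim (b := s) ?_
    · simpa using this
    filter_upwards [Ioo_mem_nhdsGT (zero_lt_one' ℝ)] with t ht
    have hmem : y + t • (a - y) ∈ interior d :=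
      hconv.1.add_smul_sub_mem_interior hy haf ⟨ht.1, ht.2.le⟩
    have h1 := hint _ hmem
    have h2 := hconv.2 hy (interior_subset haf) (sub_nonneg.2 ht.2.le) ht.1.le (by ring)
    have h3 : (1 - t) • y + t • a = y + t • (a - y) := by module
    rw [h3, smul_eq_mul, smul_eq_mul] at h2
    nlinarith
  refine mem_domSubdiff_of_forall_le hf hzf ((-κ)⁻¹ • v) fun y hy => ?_
  have h1 := hall y hy
  have h2 : ((-κ)⁻¹ • v) (y - z) = (-κ)⁻¹ * (v y - v z) := by simp
  rw [h2, ← le_sub_iff_add_le', inv_mul_le_iff₀ (neg_pos.2 hκneg)]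
  simp only [hr] at h1 hzs
  linarith

/-- `z` satisfies the optimality condition of the minimization of `α g + f - v` over `dom g`. -/
def IsProxPoint (K : Set X) (g f : X → EReal) (α : ℝ) (v : StrongDual ℝ X) (z : X) : Prop :=
  z ∈ effDomain K g ∧ z ∈ domSubdiff f ∧ ∀ u ∈ effDomain K g,
    α * (g z).toReal + v (u - z) ≤ α * (g u).toReal + grad f z (u - z)

theorem IsBregmanProx.isProxPoint [FiniteDimensional ℝ X] {K : Set X} {g f : X → EReal}
    (hg : IsProperConvexLSC K g) (hf : IsDistanceGenerating (effDomain K g) f)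
    (hne : (effDomain K g ∩ domSubdiff f).Nonempty) {α : ℝ} (hα : 0 < α) {Δ : StrongDual ℝ X}
    {xbar z : X} (h : IsBregmanProx K g f α Δ xbar z) :
    IsProxPoint K g f α (grad f xbar - α • Δ) z := by
  obtain ⟨hz, hmin⟩ := h
  have hmin' : ∀ u ∈ effDomain K g, (f z).toReal + (α * (g z).toReal + (α • Δ - grad f xbar) z) ≤
      (f u).toReal + (α * (g u).toReal + (α • Δ - grad f xbar) u) := by
    intro u hu
    have := hmin hu
    simp only [Set.mem_ofPred_eq, bregman, map_sub] at this
    simp only [sub_apply, smul_apply, smul_eq_mul]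
    linarith
  have hφ : ConvexOn ℝ (effDomain K g)
      fun u => α * (g u).toReal + (α • Δ - grad f xbar) u := by
    refine ConvexOn.add (hg.convexOn.smul hα.le) ?_
    exact ((α • Δ - grad f xbar).toLinearMap.convexOn hg.convexOn.1)
  obtain ⟨a, ha, haf⟩ := hne
  have hzd : z ∈ domSubdiff f :=
    mem_domSubdiff_of_isMinOn_add hf.proper hφ ha (hf.differentiable a haf).1 hz (hf.subset hz)
      fun u hu _ => hmin' u hu
  refine ⟨hz, hzd, fun u hu => ?_⟩
  have hder : HasDerivAt (fun t : ℝ => (f (z + t • (u - z))).toReal) (grad f z (u - z)) 0 := by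
    have h1 : HasFDerivAt (fun y => (f y).toReal) (grad f z) (z + (0 : ℝ) • (u - z)) := by
      rw [zero_smul, add_zero]; exact (hf.differentiable z hzd).2.hasFDerivAt
    have h2 : HasDerivAt (fun t : ℝ => z + t • (u - z)) (u - z) 0 := by
      simpa using ((hasDerivAt_id (0 : ℝ)).smul_const (u - z)).const_add z
    exact h1.comp_hasDerivAt (0 : ℝ) h2
  have hlim := hder.tendsto_slope_zero_right
  simp only [zero_add, zero_smul, add_zero] at hlim
  have key : (grad f xbar - α • Δ) (u - z) + α * (g z).toReal - α * (g u).toReal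
      ≤ grad f z (u - z) := by
    refine ge_of_tendsto hlim ?_
    filter_upwards [Ioo_mem_nhdsGT (zero_lt_one' ℝ)] with t ht
    have h3 : (1 - t) • z + t • u = z + t • (u - z) := by module
    have h2 := hφ.2 hz hu (sub_nonneg.2 ht.2.le) ht.1.le (by ring)
    have hmem := hg.convexOn.1 hz hu (sub_nonneg.2 ht.2.le) ht.1.le (by ring)
    rw [h3] at h2 hmem
    have h4 := hmin' _ hmem
    rw [smul_eq_mul, le_inv_mul_iff₀ ht.1]
    simp only [smul_eq_mul, sub_apply, smul_apply,
      map_sub] at h2 h4 ⊢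
    nlinarith
  linarith

theorem IsDistanceGenerating.half_sq_le_bregman {G : Set X} {f : X → EReal}
    (hf : IsDistanceGenerating G f) {x y : X} (hx : x ∈ effDomain Set.univ f)
    (hy : y ∈ domSubdiff f) : 1 / 2 * ‖x - y‖ ^ 2 ≤ bregman f x y := by
  have := hf.strongly_convex x hx y hy
  unfold bregman; linarith

theorem IsDistanceGenerating.sq_le_grad_sub {G : Set X} {f : X → EReal}
    (hf : IsDistanceGenerating G f) {x y : X} (hx : x ∈ domSubdiff f)
    (hy : y ∈ domSubdiff f) : ‖x - y‖ ^ 2 ≤ (grad f x - grad f y) (x - y) := by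
  have h1 := hf.strongly_convex x hx.1 y hy
  have h2 := hf.strongly_convex y hy.1 x hx
  rw [norm_sub_rev y x] at h2
  simp only [sub_apply, map_sub] at *
  linarith

theorem IsDistanceGenerating.norm_sub_le_of_isProxPoint {G : Set X} {f : X → EReal}
    (hf : IsDistanceGenerating G f) {K : Set X} {g : X → EReal} {α : ℝ}
    {v₁ v₂ : StrongDual ℝ X} {z₁ z₂ : X} (h₁ : IsProxPoint K g f α v₁ z₁)
    (h₂ : IsProxPoint K g f α v₂ z₂) : ‖z₁ - z₂‖ ≤ ‖v₁ - v₂‖ := by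
  have h3 := h₁.2.2 z₂ h₂.1
  have h4 := h₂.2.2 z₁ h₁.1
  have h5 := hf.sq_le_grad_sub h₁.2.1 h₂.2.1
  have h6 : (v₁ - v₂) (z₁ - z₂) ≤ ‖v₁ - v₂‖ * ‖z₁ - z₂‖ :=
    (le_abs_self _).trans ((v₁ - v₂).le_opNorm _)
  simp only [sub_apply, map_sub] at *
  by_contra! hlt
  nlinarith [norm_nonneg (v₁ - v₂)]

/-- The gradients of `f` are bounded on sublevel sets of `y ↦ D(u, y)`. -/
theorem IsDistanceGenerating.exists_norm_grad_le [FiniteDimensional ℝ X] {G : Set X} {f : X → EReal}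
    (hf : IsDistanceGenerating G f) {u : X}
    (hu : u ∈ domSubdiff f) (R : ℝ) :
    ∃ B, ∀ y ∈ domSubdiff f, bregman f u y ≤ R → ‖grad f y‖ ≤ B := by
  obtain ⟨hu1, hu2⟩ := hf.differentiable u hu
  have hc : ContinuousAt (fun z => (f z).toReal) u := hu2.continuousAt
  have h1 : ∀ᶠ z in 𝓝 u, z ∈ effDomain Set.univ f ∧ (f z).toReal < (f u).toReal + 1 :=
    (show ∀ᶠ z in 𝓝 u, z ∈ effDomain Set.univ f from mem_interior_iff_mem_nhds.1 hu1).and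
      (hc.eventually_lt continuousAt_const (by simp))
  obtain ⟨r, hr, hball⟩ := Metric.nhds_basis_closedBall.eventually_iff.1 h1
  refine ⟨(|R| + 1) / r, fun y hy hR => ?_⟩
  refine ContinuousLinearMap.opNorm_le_of_unit_norm (by positivity) fun h hh => ?_
  have key : ∀ h : X, ‖h‖ = 1 → grad f y h ≤ (|R| + 1) / r := by
    intro h hh
    have hmem : u + r • h ∈ Metric.closedBall u r := by
      simp [norm_smul, hh, abs_of_pos hr]
    obtain ⟨h3, h4⟩ := hball hmem
    have h5 := hf.strongly_convex _ h3 y hy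
    have h6 : u + r • h - y = (u - y) + r • h := by abel
    rw [h6, map_add, map_smul, smul_eq_mul] at h5
    rw [le_div_iff₀ hr]
    unfold bregman at hR
    have := le_abs_self R
    nlinarith [sq_nonneg ‖u - y + r • h‖]
  rw [Real.norm_eq_abs, abs_le']
  refine ⟨key h hh, ?_⟩
  have := key (-h) (by simpa using hh)
  simpa using this

/-- Limits of points of `dom ∂f` with convergent gradients are in `dom ∂f`. -/
theorem IsDistanceGenerating.mem_domSubdiff_of_tendsto {G : Set X} {f : X → EReal}
    (hf : IsDistanceGenerating G f) {y : ℕ → X} {x : X} {v : StrongDual ℝ X}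
    (hy : ∀ n, y n ∈ domSubdiff f) (hx : Tendsto y atTop (𝓝 x))
    (hv : Tendsto (fun n => grad f (y n)) atTop (𝓝 v)) : x ∈ domSubdiff f := by
  have key : ∀ u ∈ effDomain Set.univ f, f x ≤ (((f u).toReal - v (u - x) : ℝ) : EReal) := by
    intro u hu
    refine le_of_forall_lt fun b hb => ?_
    obtain ⟨b', hb1, hb2⟩ := EReal.lt_iff_exists_real_btwn.1 hb
    have h1 : ∀ᶠ n in atTop, (b' : EReal) < f (y n) := by
      have := hf.proper.lsc x trivial _ hb2
      rw [nhdsWithin_univ] at this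
      exact hx.eventually this
    have hlim : Tendsto (fun n => (f u).toReal - grad f (y n) (u - y n)) atTop
        (𝓝 ((f u).toReal - v (u - x))) := by
      refine tendsto_const_nhds.sub ?_
      exact (isBoundedBilinearMap_apply.continuous.tendsto (v, u - x)).comp
        (hv.prodMk_nhds (tendsto_const_nhds.sub hx))
    refine hb1.trans_le (EReal.coe_le_coe_iff.2 (ge_of_tendsto hlim ?_))
    filter_upwards [h1] with n hn
    rw [← coe_toReal_of_mem_effDomain hf.proper (hy n).1, EReal.coe_lt_coe_iff] at hn
    have := hf.strongly_convex u hu _ (hy n)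
    nlinarith [sq_nonneg ‖u - y n‖]
  have hx' : x ∈ effDomain Set.univ f :=
    ⟨trivial, (key (y 0) (hy 0).1).trans_lt (EReal.coe_lt_top _)⟩
  refine mem_domSubdiff_of_forall_le hf.proper hx' v fun u hu => ?_
  have := key u hu
  rw [← coe_toReal_of_mem_effDomain hf.proper hx', EReal.coe_le_coe_iff] at this
  linarith

/-- The weight of `‖x - w'‖²` in the Lyapunov function. -/
noncomputable def anchorWeight (c : ℝ) : ℝ := c * (2 - c) / 2

/-- The weight of `‖x - x'‖²` in the Lyapunov function. -/
noncomputable def stepWeight (c : ℝ) : ℝ := 3 / 4 * (c * (1 - c) / (2 - c))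

/-- The parameter of Young's inequality for the sampling noise. -/
noncomputable def youngWeight (c : ℝ) : ℝ := 2 * (1 - c) ^ 2 / (2 - c)

theorem weights_polynomial_bound {c p : ℝ} (hc0 : 0 < c) (hc1 : c < 1) (hp0 : 0 < p)
    (hp1 : p < 1) :
    2 * p ^ 2 * (1 - p) * (1 - c) * (2 - c) + p * (1 - p) * c * (2 - c) ^ 4 / 4 ≤ 3 / 4 := by
  have h1 : p ^ 2 * (1 - p) ≤ 3 / 20 := by
    nlinarith [mul_nonneg hp0.le (sq_nonneg (p - 2 / 3)), sq_nonneg (p - 2 / 3)]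
  have h2 : p * (1 - p) ≤ 1 / 4 := by nlinarith [sq_nonneg (p - 1 / 2)]
  have h3 : (2 - c) ^ 3 ≤ 8 := by
    calc (2 - c) ^ 3 ≤ 2 ^ 3 := pow_le_pow_left₀ (by linarith) (by linarith) 3
      _ = 8 := by norm_num
  have h4 : 0 ≤ (1 - c) * (2 - c) := mul_nonneg (by linarith) (by linarith)
  have h5 : 0 ≤ c * (2 - c) := mul_nonneg hc0.le (by linarith)
  have h6 : c * (2 - c) ^ 4 ≤ c * (2 - c) * 8 := by
    calc c * (2 - c) ^ 4 = c * (2 - c) * (2 - c) ^ 3 := by ring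
      _ ≤ _ := mul_le_mul_of_nonneg_left h3 h5
  have h7 : p * (1 - p) * (c * (2 - c) ^ 4) ≤ 1 / 4 * (c * (2 - c) * 8) :=
    mul_le_mul h2 h6 (mul_nonneg hc0.le (by positivity)) (by norm_num)
  have h8 := mul_le_mul_of_nonneg_right h1 h4
  nlinarith

/-- The quadratic form in the distances between the current two iterates and the two possible next
iterates is coercive, when the next iterates are close to each other. -/
theorem quadratic_form_lower_bound {c p dg yg db yb d h : ℝ} (hc0 : 0 < c) (hc1 : c < 1)
    (hp0 : 0 < p) (hp1 : p < 1) (hdg : 0 ≤ dg) (hdb : 0 ≤ db)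
    (hyb : 0 ≤ yb) (hdh : dg ≤ db + h) (hyh : yb ≤ yg + h)
    (hd : h ^ 2 ≤ c * (1 - c) ^ 2 * d ^ 2) :
    p * c ^ 2 / 2 * (p * dg ^ 2 + (1 - p) * db ^ 2) ≤
      p * ((1 - c * (1 - p) - youngWeight c - stepWeight c - anchorWeight c) * dg ^ 2
        + c * (1 - p) * yg ^ 2)
      + (1 - p) * ((1 - c * (1 - p) - youngWeight c - stepWeight c) * db ^ 2
        + (c * (1 - p) - anchorWeight c) * yb ^ 2) + stepWeight c * d ^ 2 := by
  have hs : 0 < 2 - c := by linarith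
  have hq : 0 < 1 - p := by linarith
  set τ := 1 / 4 * (c * (1 - c) / (2 - c)) with hτ
  have hτ0 : 0 < τ := by
    have : 0 < 1 - c := by linarith
    positivity
  have hE : stepWeight c = 3 * τ := by unfold stepWeight; rw [hτ]; ring
  set l := anchorWeight c with hl
  have hA : 1 - c * (1 - p) - youngWeight c = p * l + 4 * τ + p * c ^ 2 / 2 := by
    rw [hl, hτ]; unfold youngWeight anchorWeight; field_simp; ring
  have hy : - (2 * p ^ 2 * h ^ 2) ≤ c * (p * yg ^ 2 - (p - c / 2) * yb ^ 2) := by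
    rcases le_total p (c / 2) with hpc | hpc
    · have : 0 ≤ c * (p * yg ^ 2 - (p - c / 2) * yb ^ 2) := by
        refine mul_nonneg hc0.le ?_
        have := mul_nonneg (sub_nonneg.2 hpc) (sq_nonneg yb)
        nlinarith [mul_nonneg hp0.le (sq_nonneg yg)]
      nlinarith [mul_nonneg (sq_nonneg p) (sq_nonneg h)]
    · have h1 : yb ^ 2 ≤ (yg + h) ^ 2 := pow_le_pow_left₀ hyb hyh 2
      have h2 := mul_le_mul_of_nonneg_left h1 (mul_nonneg hc0.le (sub_nonneg.2 hpc))
      have h3 : 0 ≤ c * p * h ^ 2 := by positivity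
      nlinarith [sq_nonneg (c * yg - 2 * (p - c / 2) * h)]
  have hl0 : 0 < l := by rw [hl]; unfold anchorWeight; positivity
  have hdd : - (p * (1 - p) * l ^ 2 * h ^ 2) ≤
      4 * τ * (p * (1 - p) * l * (db ^ 2 - dg ^ 2) + τ * (p * dg ^ 2 + (1 - p) * db ^ 2)) := by
    have h1 : - (h * (db + dg)) ≤ db ^ 2 - dg ^ 2 := by nlinarith
    have h2 := mul_le_mul_of_nonneg_left h1 (by positivity : 0 ≤ 4 * τ * (p * (1 - p) * l))
    nlinarith [mul_nonneg hp0.le (sq_nonneg (2 * τ * dg - (1 - p) * l * h)),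
      mul_nonneg hq.le (sq_nonneg (2 * τ * db - p * l * h))]
  have hfin : (8 * τ * p ^ 2 * (1 - p) + p * (1 - p) * l ^ 2) * h ^ 2 ≤ 12 * τ ^ 2 * d ^ 2 := by
    refine (mul_le_mul_of_nonneg_left hd (by positivity)).trans ?_
    rw [← mul_assoc]
    refine mul_le_mul_of_nonneg_right ?_ (sq_nonneg d)
    have h1 := weights_polynomial_bound hc0 hc1 hp0 hp1
    have h2 : 12 * τ ^ 2 - (8 * τ * p ^ 2 * (1 - p) + p * (1 - p) * l ^ 2) * (c * (1 - c) ^ 2)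
        = c ^ 2 * (1 - c) ^ 2 / (2 - c) ^ 2 * (3 / 4 -
        (2 * p ^ 2 * (1 - p) * (1 - c) * (2 - c) + p * (1 - p) * c * (2 - c) ^ 4 / 4)) := by
      rw [hl, hτ]; unfold anchorWeight; field_simp; ring
    have h3 := mul_nonneg (by positivity : 0 ≤ c ^ 2 * (1 - c) ^ 2 / (2 - c) ^ 2)
      (sub_nonneg.2 h1)
    linarith
  rw [hE, hA]
  have hcl : c * (1 - p) - l = - (c * (p - c / 2)) := by rw [hl]; unfold anchorWeight; ring
  rw [hcl]
  have hy' := mul_le_mul_of_nonneg_left hy (by positivity : 0 ≤ 4 * τ * (1 - p))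
  have key : 0 ≤ 4 * τ * ((p * (1 - p) * l * (db ^ 2 - dg ^ 2)
      + τ * (p * dg ^ 2 + (1 - p) * db ^ 2))
      + (1 - p) * (c * (p * yg ^ 2 - (p - c / 2) * yb ^ 2)) + 3 * τ * d ^ 2) := by
    linarith
  have key' := nonneg_of_mul_nonneg_right key (by positivity)
  linarith

/-- The average over the batch of `Fξ x - Fξ w'`. -/
noncomputable def batchDiff {M b : ℕ} (Fξ : Fin M → X → StrongDual ℝ X) (ξ : Fin b → Fin M)
    (x w' : X) : StrongDual ℝ X :=
  (1 / (b : ℝ)) • ∑ j, (Fξ (ξ j) x - Fξ (ξ j) w')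

theorem batchEstimator_eq {M b : ℕ} (hb : 1 ≤ b) (F : X → StrongDual ℝ X)
    (Fξ : Fin M → X → StrongDual ℝ X) (ξ : Fin b → Fin M) (x w w' : X) :
    batchEstimator F Fξ ξ x w w' = F w + batchDiff Fξ ξ x w' := by
  have hb' : (b : ℝ) ≠ 0 := by positivity
  unfold batchEstimator batchDiff
  simp only [add_sub_assoc]
  rw [Finset.sum_add_distrib, smul_add, Finset.sum_const, Finset.card_univ, Fintype.card_fin,
    ← Nat.cast_smul_eq_nsmul ℝ, smul_smul, one_div_mul_cancel hb', one_smul]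

theorem PMF.sum_toReal {ι : Type*} [Fintype ι] (Q : PMF ι) : ∑ i, (Q i).toReal = 1 := by
  rw [← ENNReal.toReal_sum fun i _ => Q.apply_ne_top i, ← tsum_fintype (L := .unconditional _),
    Q.tsum_coe, ENNReal.toReal_one]

theorem sum_prod_mul_apply {ι κ : Type*} [Fintype ι] [DecidableEq ι] [Fintype κ] (P : κ → ℝ)
    (hP : ∑ i, P i = 1) (φ : κ → ℝ) (j₀ : ι) :
    ∑ J : ι → κ, (∏ j, P (J j)) * φ (J j₀) = ∑ i, P i * φ i := by
  classical
  have h1 : ∀ J : ι → κ, (∏ j, P (J j)) * φ (J j₀) =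
      ∏ j, (P (J j) * if j = j₀ then φ (J j) else 1) := by
    intro J
    rw [Finset.prod_mul_distrib, Finset.prod_ite_eq' Finset.univ j₀ fun j => φ (J j)]
    simp
  simp_rw [h1]
  rw [← Fintype.piFinset_univ, ← Finset.prod_univ_sum (fun _ => Finset.univ)
    (fun j i => P i * if j = j₀ then φ i else 1)]
  rw [Finset.prod_eq_single j₀]
  · simp
  · intro j _ hj
    simp [hj, hP]
  · simp

theorem sum_prod_eq_one {ι κ : Type*} [Fintype ι] [DecidableEq ι] [Fintype κ] (P : κ → ℝ)
    (hP : ∑ i, P i = 1) : ∑ J : ι → κ, ∏ j, P (J j) = 1 := by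
  rw [← Fintype.piFinset_univ, ← Finset.prod_univ_sum (fun _ => Finset.univ) (fun _ i => P i)]
  simp [hP]

section Oracle

variable {M b : ℕ} {G : Set X} {F : X → StrongDual ℝ X} {Fξ : Fin M → X → StrongDual ℝ X}
  {Q : X → X → PMF (Fin M)} {Lbar : ℝ}

theorem IsVariableLipschitzOracle.sum_batchDiff_apply (hb : 1 ≤ b)
    (ho : IsVariableLipschitzOracle G F Fξ Q Lbar) {x w : X} (hx : x ∈ G) (hw : w ∈ G) (v : X) :
    ∑ J : Fin b → Fin M, (∏ j, (Q x w (J j)).toReal) * batchDiff Fξ J x w v =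
      (F x - F w) v := by
  have hb' : (b : ℝ) ≠ 0 := by positivity
  have h1 : ∀ J : Fin b → Fin M, (∏ j, (Q x w (J j)).toReal) * batchDiff Fξ J x w v =
      ∑ k, (1 / (b : ℝ)) * ((∏ j, (Q x w (J j)).toReal) * (Fξ (J k) x - Fξ (J k) w) v) := by
    intro J
    rw [← Finset.mul_sum, ← Finset.mul_sum]
    unfold batchDiff
    rw [smul_apply, sum_apply, smul_eq_mul]
    ring
  simp_rw [h1]
  rw [Finset.sum_comm]
  simp_rw [← Finset.mul_sum]
  simp_rw [sum_prod_mul_apply (fun i => (Q x w i).toReal) (PMF.sum_toReal _)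
    (fun i => (Fξ i x - Fξ i w) v)]
  rw [Finset.sum_const, Finset.card_univ, Fintype.card_fin, nsmul_eq_mul,
    ← mul_assoc, one_div, inv_mul_cancel₀ hb', one_mul,
    ← ho.unbiased x hx w hw x hx, ← ho.unbiased x hx w hw w hw, ← Finset.sum_sub_distrib,
    sum_apply]
  simp only [sub_apply, smul_apply, smul_eq_mul, mul_sub]

theorem norm_batchDiff_sq_le (hb : 1 ≤ b) (J : Fin b → Fin M) (x w : X) :
    ‖batchDiff Fξ J x w‖ ^ 2 ≤ (1 / (b : ℝ)) * ∑ k, ‖Fξ (J k) x - Fξ (J k) w‖ ^ 2 := by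
  have hb' : (0 : ℝ) < b := by positivity
  have h1 : ‖batchDiff Fξ J x w‖ ≤ (1 / (b : ℝ)) * ∑ k, ‖Fξ (J k) x - Fξ (J k) w‖ := by
    unfold batchDiff
    rw [norm_smul, Real.norm_of_nonneg (by positivity)]
    gcongr
    exact norm_sum_le _ _
  have h2 := sq_sum_le_card_mul_sum_sq (s := Finset.univ)
    (f := fun k => ‖Fξ (J k) x - Fξ (J k) w‖)
  rw [Finset.card_univ, Fintype.card_fin] at h2
  calc ‖batchDiff Fξ J x w‖ ^ 2 ≤ ((1 / (b : ℝ)) * ∑ k, ‖Fξ (J k) x - Fξ (J k) w‖) ^ 2 := by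
        gcongr
    _ = (1 / (b : ℝ)) ^ 2 * (∑ k, ‖Fξ (J k) x - Fξ (J k) w‖) ^ 2 := by ring
    _ ≤ (1 / (b : ℝ)) ^ 2 * (b * ∑ k, ‖Fξ (J k) x - Fξ (J k) w‖ ^ 2) := by gcongr
    _ = _ := by field_simp

theorem IsVariableLipschitzOracle.sum_norm_batchDiff_sq_le (hb : 1 ≤ b)
    (ho : IsVariableLipschitzOracle G F Fξ Q Lbar) {x w : X} (hx : x ∈ G) (hw : w ∈ G) :
    ∑ J : Fin b → Fin M, (∏ j, (Q x w (J j)).toReal) * ‖batchDiff Fξ J x w‖ ^ 2 ≤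
      Lbar ^ 2 * ‖x - w‖ ^ 2 := by
  have hb' : (b : ℝ) ≠ 0 := by positivity
  calc ∑ J : Fin b → Fin M, (∏ j, (Q x w (J j)).toReal) * ‖batchDiff Fξ J x w‖ ^ 2
      ≤ ∑ J : Fin b → Fin M, ∑ k, (1 / (b : ℝ)) *
        ((∏ j, (Q x w (J j)).toReal) * ‖Fξ (J k) x - Fξ (J k) w‖ ^ 2) := by
        refine Finset.sum_le_sum fun J _ => ?_
        rw [← Finset.mul_sum, ← Finset.mul_sum]
        calc _ ≤ (∏ j, (Q x w (J j)).toReal) *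
              ((1 / (b : ℝ)) * ∑ k, ‖Fξ (J k) x - Fξ (J k) w‖ ^ 2) :=
              mul_le_mul_of_nonneg_left (norm_batchDiff_sq_le hb J x w)
                (Finset.prod_nonneg fun _ _ => ENNReal.toReal_nonneg)
          _ = _ := by ring
    _ = ∑ i, (Q x w i).toReal * ‖Fξ i x - Fξ i w‖ ^ 2 := by
        rw [Finset.sum_comm]
        simp_rw [← Finset.mul_sum]
        simp_rw [sum_prod_mul_apply (fun i => (Q x w i).toReal) (PMF.sum_toReal _)
          (fun i => ‖Fξ i x - Fξ i w‖ ^ 2)]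
        rw [Finset.sum_const, Finset.card_univ, Fintype.card_fin, nsmul_eq_mul,
          ← mul_assoc, one_div, inv_mul_cancel₀ hb', one_mul]
    _ ≤ _ := ho.lipschitz x hx w hw

theorem IsVariableLipschitzOracle.norm_sub_sq_le (ho : IsVariableLipschitzOracle G F Fξ Q Lbar)
    {x y : X} (hx : x ∈ G) (hy : y ∈ G) : ‖F x - F y‖ ^ 2 ≤ Lbar ^ 2 * ‖x - y‖ ^ 2 := by
  refine le_trans ?_ (ho.lipschitz x hx y hy)
  set P : Fin M → ℝ := fun i => (Q x y i).toReal
  have hP : ∑ i, P i = 1 := PMF.sum_toReal _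
  have hP0 : ∀ i, 0 ≤ P i := fun i => ENNReal.toReal_nonneg
  have h1 : ‖F x - F y‖ ≤ ∑ i, P i * ‖Fξ i x - Fξ i y‖ := by
    rw [← ho.unbiased x hx y hy x hx, ← ho.unbiased x hx y hy y hy, ← Finset.sum_sub_distrib]
    refine (norm_sum_le _ _).trans (Finset.sum_le_sum fun i _ => ?_)
    have h2 : (Q x y i).toReal • Fξ i x - (Q x y i).toReal • Fξ i y =
        P i • (Fξ i x - Fξ i y) := by
      ext v; simp [P, mul_sub]
    rw [h2, norm_smul, Real.norm_of_nonneg (hP0 i)]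
  calc ‖F x - F y‖ ^ 2 ≤ (∑ i, P i * ‖Fξ i x - Fξ i y‖) ^ 2 := by gcongr
    _ ≤ ∑ i, P i * ‖Fξ i x - Fξ i y‖ ^ 2 :=
        Real.pow_arith_mean_le_arith_mean_pow Finset.univ P _ (fun i _ => hP0 i) hP
          (fun i _ => norm_nonneg _) 2

end Oracle

/-- The Lyapunov function, in terms of two consecutive iterates `x'`, `x` and the anchor `w'`. -/
noncomputable def lyapunov (f : X → EReal) (F : X → StrongDual ℝ X) (u : X) (α p c : ℝ)
    (x x' w' : X) : ℝ :=
  2 * bregman f u x + 2 * (c * (1 - p)) * bregman f u x' + 2 * α * (F x - F w') (u - x)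
    + anchorWeight c * ‖x - w'‖ ^ 2 + stepWeight c * ‖x - x'‖ ^ 2

/-- The data of one iteration satisfy the optimality condition of the Bregman proximal step with
estimator `F w + η`. -/
def IsStep (K : Set X) (g f : X → EReal) (F : X → StrongDual ℝ X) (α γ : ℝ) (x x' w : X)
    (η : StrongDual ℝ X) (z : X) : Prop :=
  IsProxPoint K g f α (γ • grad f x + (1 - γ) • grad f x' - α • (F w + η)) z

theorem IsStep.bregman_le {K : Set X} {g f : X → EReal} {F : X → StrongDual ℝ X} {α γ : ℝ}
    {x x' w z u : X} {η : StrongDual ℝ X} (hg : IsProperConvexLSC K g)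
    (hf : IsDistanceGenerating (effDomain K g) f) (hF : IsMonotoneOn (effDomain K g) F)
    (hα : 0 < α) (hγ0 : 0 ≤ γ) (hγ1 : γ ≤ 1) (hx : x ∈ domSubdiff f) (hx' : x' ∈ domSubdiff f)
    (hu : u ∈ solutionSet K g F) (h : IsStep K g f F α γ x x' w η z) :
    2 * bregman f u z + 2 * (1 - γ) * bregman f u x + 2 * α * (F z - F w) (u - z)
        + γ * ‖z - x‖ ^ 2 + (1 - γ) * ‖z - x'‖ ^ 2 ≤
      2 * bregman f u x + 2 * (1 - γ) * bregman f u x' + 2 * α * η (u - x)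
        + 2 * α * η (x - z) := by
  obtain ⟨hz, hzf, hopt⟩ := h
  have h1 := hopt u hu.1
  have h2 : (g u).toReal ≤ F u (z - u) + (g z).toReal := by
    have := hu.2 z hz.1
    rwa [← coe_toReal_of_mem_effDomain hg hu.1, ← coe_toReal_of_mem_effDomain hg hz,
      ← EReal.coe_add, EReal.coe_le_coe_iff] at this
  have h3 := hF z hz u hu.1
  have h4 := mul_le_mul_of_nonneg_left
    (hf.half_sq_le_bregman (hf.subset hz) hx) hγ0
  have h5 := mul_le_mul_of_nonneg_left
    (hf.half_sq_le_bregman (hf.subset hz) hx') (sub_nonneg.2 hγ1)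
  have h6 := mul_le_mul_of_nonneg_left (show (g u).toReal - (g z).toReal ≤ F z (z - u) by
    simp only [sub_apply] at h3; linarith) hα.le
  unfold bregman at *
  simp only [sub_apply, add_apply, smul_apply, smul_eq_mul, map_sub] at *
  linarith

theorem IsStep.lyapunov_le {K : Set X} {g f : X → EReal} {F : X → StrongDual ℝ X} {α p c : ℝ}
    {x x' w w' z u : X} {η : StrongDual ℝ X} (hg : IsProperConvexLSC K g)
    (hf : IsDistanceGenerating (effDomain K g) f) (hF : IsMonotoneOn (effDomain K g) F)
    (hα : 0 < α) (hα1 : α ≤ 1 - c) (hc0 : 0 < c) (hp0 : 0 < p) (hp1 : p < 1)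
    (hx : x ∈ domSubdiff f) (hx' : x' ∈ domSubdiff f)
    (hu : u ∈ solutionSet K g F)
    (h : IsStep K g f F α (1 - c * (1 - p)) x x' w η z) :
    lyapunov f F u α p c z x w
        + (1 - c * (1 - p) - youngWeight c - stepWeight c) * ‖z - x‖ ^ 2
        + c * (1 - p) * ‖z - x'‖ ^ 2 - anchorWeight c * ‖z - w‖ ^ 2 ≤
      lyapunov f F u α p c x x' w' + 2 * α * (η (u - x) - (F x - F w') (u - x))
        + anchorWeight c / c * ‖η‖ ^ 2 - anchorWeight c * ‖x - w'‖ ^ 2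
        - stepWeight c * ‖x - x'‖ ^ 2 := by
  have hc1 : c < 1 := by linarith
  have hcp : c * (1 - p) ≤ 1 := by nlinarith
  have hcp0 : 0 ≤ c * (1 - p) := mul_nonneg hc0.le (by linarith)
  have h1 := h.bregman_le hg hf hF hα (by linarith) (by linarith) hx hx' hu
  have h2 : η (x - z) ≤ ‖η‖ * ‖z - x‖ := by
    rw [norm_sub_rev z x]
    exact (le_abs_self _).trans (η.le_opNorm _)
  have h3 : 2 * α * (‖η‖ * ‖z - x‖) ≤
      youngWeight c * ‖z - x‖ ^ 2 + anchorWeight c / c * ‖η‖ ^ 2 := by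
    have hs : 0 < 2 - c := by linarith
    have hy : youngWeight c = (1 - c) ^ 2 * (2 / (2 - c)) := by unfold youngWeight; ring
    have hl : anchorWeight c / c = (2 / (2 - c))⁻¹ := by unfold anchorWeight; field_simp
    rw [hy, hl]
    set r := 2 / (2 - c)
    have hr : 0 < r := by positivity
    have h4 : 2 * α * (‖η‖ * ‖z - x‖) ≤ 2 * (1 - c) * (‖η‖ * ‖z - x‖) := by gcongr
    have h5 := mul_nonneg hr.le (sq_nonneg ((1 - c) * ‖z - x‖ - r⁻¹ * ‖η‖))
    have h6 : r * ((1 - c) * ‖z - x‖ - r⁻¹ * ‖η‖) ^ 2 = (1 - c) ^ 2 * r * ‖z - x‖ ^ 2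
        + r⁻¹ * ‖η‖ ^ 2 - 2 * (1 - c) * (‖η‖ * ‖z - x‖) := by
      field_simp; ring
    linarith
  have h7 := mul_le_mul_of_nonneg_left h2 (by linarith : 0 ≤ 2 * α)
  unfold lyapunov
  linarith

/-- The two possible next iterates, according to the value of the coin, are close. -/
theorem IsStep.norm_sub_le {K : Set X} {g f : X → EReal} {F : X → StrongDual ℝ X} {α γ : ℝ}
    {x x' w₁ w₂ z₁ z₂ : X} {η : StrongDual ℝ X} (hf : IsDistanceGenerating (effDomain K g) f)
    (hα : 0 < α) (h₁ : IsStep K g f F α γ x x' w₁ η z₁) (h₂ : IsStep K g f F α γ x x' w₂ η z₂) :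
    ‖z₁ - z₂‖ ≤ α * ‖F w₁ - F w₂‖ := by
  refine (hf.norm_sub_le_of_isProxPoint h₁ h₂).trans_eq ?_
  rw [← Real.norm_of_nonneg hα.le, ← norm_smul, Real.norm_of_nonneg hα.le, ← norm_neg]
  congr 1
  ext v
  simp only [sub_apply, add_apply, smul_apply, smul_eq_mul, neg_apply]
  ring

theorem lyapunov_average_le {K : Set X} {g f : X → EReal} {F : X → StrongDual ℝ X}
    {α p c : ℝ} {x x' w' zg zb u : X} {η : StrongDual ℝ X} (hg : IsProperConvexLSC K g)
    (hf : IsDistanceGenerating (effDomain K g) f) (hF : IsMonotoneOn (effDomain K g) F)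
    (hα : 0 < α) (hα1 : α ≤ 1 - c) (hc0 : 0 < c) (hp0 : 0 < p) (hp1 : p < 1)
    (hx : x ∈ domSubdiff f) (hx' : x' ∈ domSubdiff f)
    (hFx : ‖F x - F x'‖ ^ 2 ≤ c * ‖x - x'‖ ^ 2) (hu : u ∈ solutionSet K g F)
    (hzg : IsStep K g f F α (1 - c * (1 - p)) x x' x η zg)
    (hzb : IsStep K g f F α (1 - c * (1 - p)) x x' x' η zb) :
    p * (lyapunov f F u α p c zg x x + p * c ^ 2 / 2 * ‖zg - x‖ ^ 2)
      + (1 - p) * (lyapunov f F u α p c zb x x' + p * c ^ 2 / 2 * ‖zb - x‖ ^ 2) ≤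
    lyapunov f F u α p c x x' w' + 2 * α * (η (u - x) - (F x - F w') (u - x))
        + anchorWeight c / c * ‖η‖ ^ 2 - anchorWeight c * ‖x - w'‖ ^ 2 := by
  have hc1 : c < 1 := by linarith
  have h1 := hzg.lyapunov_le (w' := w') hg hf hF hα hα1 hc0 hp0 hp1 hx hx' hu
  have h2 := hzb.lyapunov_le (w' := w') hg hf hF hα hα1 hc0 hp0 hp1 hx hx' hu
  have h3 := hzg.norm_sub_le hf hα hzb
  have h4 : ‖zg - zb‖ ^ 2 ≤ c * (1 - c) ^ 2 * ‖x - x'‖ ^ 2 := by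
    calc ‖zg - zb‖ ^ 2 ≤ (α * ‖F x - F x'‖) ^ 2 := by gcongr
      _ = α ^ 2 * ‖F x - F x'‖ ^ 2 := by ring
      _ ≤ (1 - c) ^ 2 * (c * ‖x - x'‖ ^ 2) := by gcongr
      _ = _ := by ring
  have h5 : ‖zg - x‖ ≤ ‖zb - x‖ + ‖zg - zb‖ := by
    have := norm_add_le (zg - zb) (zb - x)
    rw [sub_add_sub_cancel] at this; linarith
  have h6 : ‖zb - x'‖ ≤ ‖zg - x'‖ + ‖zg - zb‖ := by
    have := norm_add_le (zb - zg) (zg - x')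
    rw [sub_add_sub_cancel, norm_sub_rev zb zg] at this; linarith
  have h7 := quadratic_form_lower_bound hc0 hc1 hp0 hp1 (norm_nonneg _) (norm_nonneg _)
    (norm_nonneg _) h5 h6 h4
  have h8 := mul_le_mul_of_nonneg_left h1 hp0.le
  have h9 := mul_le_mul_of_nonneg_left h2 (sub_nonneg.2 hp1.le)
  linarith

/-- The expected decrease of the Lyapunov function over a coin toss and the sampling of a batch. -/
theorem sum_lyapunov_le {M b : ℕ} (hb : 1 ≤ b) {K : Set X} {g f : X → EReal}
    {F : X → StrongDual ℝ X} {Fξ : Fin M → X → StrongDual ℝ X} {Q : X → X → PMF (Fin M)}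
    {α p c Lbar ε : ℝ} {x x' w' u : X} {z : Bool → (Fin b → Fin M) → X}
    (hg : IsProperConvexLSC K g)
    (hf : IsDistanceGenerating (effDomain K g) f) (hF : IsMonotoneOn (effDomain K g) F)
    (ho : IsVariableLipschitzOracle (effDomain K g) F Fξ Q Lbar)
    (hα : 0 < α) (hα1 : α ≤ 1 - c) (hc0 : 0 < c) (hLc : Lbar ^ 2 ≤ c) (hp0 : 0 < p) (hp1 : p < 1)
    (hε0 : 0 ≤ ε) (hε1 : ε ≤ p * c ^ 2 / 2)
    (hε2 : (anchorWeight c / c + ε) * Lbar ^ 2 ≤ anchorWeight c)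
    (hx : x ∈ effDomain K g ∩ domSubdiff f) (hx' : x' ∈ effDomain K g ∩ domSubdiff f)
    (hw' : w' ∈ effDomain K g) (hu : u ∈ solutionSet K g F)
    (hz : ∀ (coin : Bool) (J : Fin b → Fin M), ∏ j, (Q x w' (J j)).toReal ≠ 0 →
      IsStep K g f F α (1 - c * (1 - p)) x x' (if coin then x else x') (batchDiff Fξ J x w')
        (z coin J)) :
    ∑ J, ∑ coin, (∏ j, (Q x w' (J j)).toReal) * (if coin then p else 1 - p) *
        (lyapunov f F u α p c (z coin J) x (if coin then x else x')
          + ε * (‖z coin J - x‖ ^ 2 + ‖batchDiff Fξ J x w'‖ ^ 2)) ≤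
      lyapunov f F u α p c x x' w' := by
  have hFx : ‖F x - F x'‖ ^ 2 ≤ c * ‖x - x'‖ ^ 2 :=
    (ho.norm_sub_sq_le hx.1 hx'.1).trans (by gcongr)
  set P : (Fin b → Fin M) → ℝ := fun J => ∏ j, (Q x w' (J j)).toReal with hP
  have hP0 : ∀ J, 0 ≤ P J := fun J => Finset.prod_nonneg fun _ _ => ENNReal.toReal_nonneg
  have hP1 : ∑ J, P J = 1 := sum_prod_eq_one _ (PMF.sum_toReal _)
  set V := lyapunov f F u α p c x x' w' with hV
  have key : ∀ J, ∑ coin : Bool, P J * (if coin then p else 1 - p) *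
        (lyapunov f F u α p c (z coin J) x (if coin then x else x')
          + ε * (‖z coin J - x‖ ^ 2 + ‖batchDiff Fξ J x w'‖ ^ 2)) ≤
      P J * V + 2 * α * (P J * batchDiff Fξ J x w' (u - x) - P J * (F x - F w') (u - x))
        + (anchorWeight c / c + ε) * (P J * ‖batchDiff Fξ J x w'‖ ^ 2)
        - P J * (anchorWeight c * ‖x - w'‖ ^ 2) := by
    intro J
    by_cases hJ : P J = 0
    · simp [hJ]
    · have h1 := lyapunov_average_le (w' := w') hg hf hF hα hα1 hc0 hp0 hp1 hx.2 hx'.2 hFx hu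
        (hz true J hJ) (hz false J hJ)
      have h2 := mul_le_mul_of_nonneg_left h1 (hP0 J)
      have h3 := mul_le_mul_of_nonneg_left hε1
        (by positivity : 0 ≤ P J * p * ‖z true J - x‖ ^ 2)
      have h4 := mul_le_mul_of_nonneg_left hε1
        (mul_nonneg (mul_nonneg (hP0 J) (sub_nonneg.2 hp1.le)) (sq_nonneg ‖z false J - x‖))
      simp only [Fintype.sum_bool, if_true, Bool.false_eq_true, if_false]
      linarith
  refine (Finset.sum_le_sum fun J _ => key J).trans ?_
  rw [Finset.sum_sub_distrib, Finset.sum_add_distrib, Finset.sum_add_distrib, ← Finset.mul_sum,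
    ← Finset.mul_sum, Finset.sum_sub_distrib, ← Finset.sum_mul, ← Finset.sum_mul,
    ← Finset.sum_mul, hP1, ho.sum_batchDiff_apply hb hx.1 hw', one_mul, one_mul, one_mul, sub_self,
    mul_zero, add_zero]
  have hl : 0 < anchorWeight c := by
    have : 0 < 2 - c := by linarith
    unfold anchorWeight; positivity
  have h5 := mul_le_mul_of_nonneg_left (ho.sum_norm_batchDiff_sq_le hb hx.1 hw')
    (by positivity : 0 ≤ anchorWeight c / c + ε)
  have h6 := mul_le_mul_of_nonneg_right hε2 (sq_nonneg ‖x - w'‖)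
  linarith

theorem lyapunov_nonneg {K : Set X} {g f : X → EReal} {F : X → StrongDual ℝ X} {α p c : ℝ}
    {x x' w' u : X} (hf : IsDistanceGenerating (effDomain K g) f)
    (hα : 0 < α) (hα1 : α ≤ 1 - c) (hc0 : 0 < c) (hp1 : p < 1)
    (hx : x ∈ domSubdiff f) (hx' : x' ∈ domSubdiff f)
    (hFx : ‖F x - F w'‖ ^ 2 ≤ c * ‖x - w'‖ ^ 2) (hu : u ∈ effDomain K g) :
    0 ≤ lyapunov f F u α p c x x' w' := by
  have hc1 : c < 1 := by linarith
  have h1 := hf.half_sq_le_bregman (hf.subset hu) hx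
  have h2 := hf.half_sq_le_bregman (hf.subset hu) hx'
  have h3 : -(F x - F w') (u - x) ≤ ‖F x - F w'‖ * ‖u - x‖ :=
    (neg_le_abs _).trans ((F x - F w').le_opNorm _)
  have h4 : 0 ≤ stepWeight c := by
    have h5 : 0 < 2 - c := by linarith
    have h6 : 0 < 1 - c := by linarith
    unfold stepWeight; positivity
  have h5 : α ^ 2 * ‖F x - F w'‖ ^ 2 ≤ anchorWeight c * ‖x - w'‖ ^ 2 := by
    calc α ^ 2 * ‖F x - F w'‖ ^ 2 ≤ (1 - c) ^ 2 * (c * ‖x - w'‖ ^ 2) := by gcongr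
      _ = (1 - c) ^ 2 * c * ‖x - w'‖ ^ 2 := by ring
      _ ≤ _ := by
        refine mul_le_mul_of_nonneg_right ?_ (sq_nonneg _)
        unfold anchorWeight; nlinarith [mul_nonneg (sq_nonneg c) (by linarith : 0 ≤ 3 / 2 - c)]
  have h6 := mul_nonneg (mul_nonneg hc0.le (sub_nonneg.2 hp1.le))
    (h2.trans' (by positivity) : (0 : ℝ) ≤ bregman f u x')
  have h7 := mul_nonneg h4 (sq_nonneg ‖x - x'‖)
  have h8 := mul_le_mul_of_nonneg_left h3 hα.le
  unfold lyapunov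
  nlinarith [sq_nonneg (‖u - x‖ - α * ‖F x - F w'‖)]

end Step

theorem measurable_comap_of_factorsThrough {Ω σ β : Type*} [MeasurableSpace β] {H : Ω → σ}
    {φ : Ω → β} (h : φ.FactorsThrough H) : Measurable[MeasurableSpace.comap H ⊤] φ := by
  intro t _
  refine ⟨H '' (φ ⁻¹' t), trivial, ?_⟩
  ext ω
  constructor
  · rintro ⟨ω', hω', he⟩
    simpa [Set.mem_preimage, ← h he] using hω'
  · exact fun hω => ⟨ω, hω, rfl⟩

theorem comap_top_le {Ω σ : Type*} {m : MeasurableSpace Ω} [Finite σ] {H : Ω → σ}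
    (hH : ∀ s, MeasurableSet (H ⁻¹' {s})) : MeasurableSpace.comap H ⊤ ≤ m := by
  rintro _ ⟨t, _, rfl⟩
  rw [← Set.biUnion_preimage_singleton]
  exact t.toFinite.measurableSet_biUnion fun s _ => hH s

theorem integrable_of_factorsThrough {Ω σ : Type*} {m : MeasurableSpace Ω} {μ : Measure Ω}
    [IsFiniteMeasure μ] [Finite σ] {H : Ω → σ} (hH : ∀ s, MeasurableSet (H ⁻¹' {s}))
    {φ : Ω → ℝ} (h : φ.FactorsThrough H) : Integrable φ μ := by
  have hfin : (Set.range φ).Finite := by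
    rcases isEmpty_or_nonempty Ω with hΩ | hΩ
    · exact Set.range_eq_empty φ ▸ Set.finite_empty
    · refine (Set.finite_range fun s : σ => Function.extend H φ 0 s).subset ?_
      rintro _ ⟨ω, rfl⟩
      exact ⟨H ω, h.extend_apply 0 ω⟩
  obtain ⟨C, hC⟩ := (hfin.isBounded).exists_norm_le
  refine Integrable.of_bound
    ((measurable_comap_of_factorsThrough h).mono (comap_top_le hH) le_rfl).aestronglyMeasurable C
    (ae_of_all _ fun ω => hC _ ⟨ω, rfl⟩)

/-- A nonnegative supermartingale converges almost surely. -/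
theorem Supermartingale.ae_tendsto_of_nonneg {Ω : Type*} {m : MeasurableSpace Ω} {μ : Measure Ω}
    [IsFiniteMeasure μ] {𝒢 : Filtration ℕ m} {W : ℕ → Ω → ℝ} (hW : Supermartingale W 𝒢 μ)
    (h0 : ∀ n ω, 0 ≤ W n ω) : ∀ᵐ ω ∂μ, ∃ l, Tendsto (fun n => W n ω) atTop (𝓝 l) := by
  have hbdd : ∀ n, eLpNorm ((-W) n) 1 μ ≤ (∫ ω, W 0 ω ∂μ).toNNReal := by
    intro n
    rw [Pi.neg_apply, eLpNorm_neg, eLpNorm_one_eq_lintegral_enorm,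
      ← ofReal_integral_norm_eq_lintegral_enorm (hW.integrable n)]
    refine ENNReal.ofReal_le_ofReal ?_
    simp_rw [Real.norm_of_nonneg (h0 n _)]
    simpa using hW.setIntegral_le (Nat.zero_le n) MeasurableSet.univ
  filter_upwards [hW.neg.exists_ae_tendsto_of_bdd hbdd] with ω hω
  obtain ⟨l, hl⟩ := hω
  exact ⟨-l, by simpa using hl.neg⟩

theorem tendsto_zero_of_add_sum_tendsto {z y : ℕ → ℝ} (hz : ∀ n, 0 ≤ z n) (hy : ∀ n, 0 ≤ y n)
    {l : ℝ} (h : Tendsto (fun n => z n + ∑ i ∈ Finset.range n, y i) atTop (𝓝 l)) :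
    (∃ l', Tendsto z atTop (𝓝 l')) ∧ Tendsto y atTop (𝓝 0) := by
  obtain ⟨B, hB⟩ := h.bddAbove_range
  have hs : Summable y := summable_of_sum_range_le hy fun n =>
    (le_add_of_nonneg_left (hz n)).trans (hB ⟨n, rfl⟩)
  refine ⟨⟨l - ∑' i, y i, ?_⟩, hs.tendsto_atTop_zero⟩
  simpa using h.sub hs.hasSum.tendsto_sum_nat

/-- A form of the Robbins-Siegmund theorem: the process `Z` depends on a history `H` with finitely
many values, and on each fiber of the history the mean of `Z` decreases by at least that of `Y`. -/
theorem ae_tendsto_of_setIntegral_fiber_le {Ω : Type*} {m : MeasurableSpace Ω} {μ : Measure Ω}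
    [IsFiniteMeasure μ] {S : ℕ → Type*} [∀ n, Finite (S n)] {H : ∀ n, Ω → S n}
    (hH : ∀ n s, MeasurableSet (H n ⁻¹' {s}))
    (hmono : ∀ n, (H n).FactorsThrough (H (n + 1))) {Z Y : ℕ → Ω → ℝ}
    (hZ : ∀ n, (Z n).FactorsThrough (H n)) (hY : ∀ n, (Y n).FactorsThrough (H (n + 1)))
    (hZ0 : ∀ n ω, 0 ≤ Z n ω) (hY0 : ∀ n ω, 0 ≤ Y n ω)
    (hle : ∀ n ω, ∫ ω' in H n ⁻¹' {H n ω}, (Z (n + 1) ω' + Y n ω') ∂μ ≤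
      ∫ ω' in H n ⁻¹' {H n ω}, Z n ω' ∂μ) :
    ∀ᵐ ω ∂μ, (∃ l, Tendsto (fun n => Z n ω) atTop (𝓝 l)) ∧
      Tendsto (fun n => Y n ω) atTop (𝓝 0) := by
  have hcomap : Monotone fun n => MeasurableSpace.comap (H n) ⊤ := by
    refine monotone_nat_of_le_succ fun n => ?_
    rintro _ ⟨t, _, rfl⟩
    exact @measurable_comap_of_factorsThrough _ _ _ ⊤ _ _ (hmono n) t trivial
  let 𝒢 : Filtration ℕ m :=
    { seq := fun n => MeasurableSpace.comap (H n) ⊤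
      mono' := hcomap
      le' := fun n => comap_top_le (hH n) }
  have hmono' : ∀ k n, k ≤ n → (H k).FactorsThrough (H n) := by
    intro k n hkn
    induction n, hkn using Nat.le_induction with
    | base => exact fun _ _ h => h
    | succ n _ ih => exact fun _ _ h => ih (hmono n h)
  let W : ℕ → Ω → ℝ := fun n ω => Z n ω + ∑ i ∈ Finset.range n, Y i ω
  have hWf : ∀ n, (W n).FactorsThrough (H n) := by
    intro n ω ω' h
    refine congrArg₂ (· + ·) (hZ n h) (Finset.sum_congr rfl fun i hi => ?_)
    exact hY i (hmono' (i + 1) n (Finset.mem_range.1 hi) h)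
  have hint : ∀ n, Integrable (W n) μ := fun n => integrable_of_factorsThrough (hH n) (hWf n)
  have hW : Supermartingale W 𝒢 μ := by
    refine supermartingale_of_setIntegral_succ_le
      (fun n => (measurable_comap_of_factorsThrough (hWf n)).stronglyMeasurable) hint ?_
    rintro n _ ⟨t, _, rfl⟩
    have hsplit : ∀ φ : Ω → ℝ, Integrable φ μ → ∫ ω in H n ⁻¹' t, φ ω ∂μ =
        ∑ s ∈ t.toFinite.toFinset, ∫ ω in H n ⁻¹' {s}, φ ω ∂μ := by
      intro φ hφ
      rw [← integral_biUnion_finset _ (fun s _ => hH n s) _ fun s _ => hφ.integrableOn]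
      · congr 2
        ext ω; simp
      · intro s _ s' _ hne
        exact Disjoint.preimage _ (by simpa using hne)
    rw [hsplit _ (hint _), hsplit _ (hint _)]
    refine Finset.sum_le_sum fun s _ => ?_
    rcases (H n ⁻¹' {s}).eq_empty_or_nonempty with he | ⟨ω, hω⟩
    · simp [he]
    · obtain rfl : H n ω = s := hω
      have h1 := hle n ω
      have hS : Integrable (fun ω' => ∑ i ∈ Finset.range n, Y i ω') μ :=
        integrable_finsetSum _ fun i _ => integrable_of_factorsThrough (hH (i + 1)) (hY i)
      have hZn := integrable_of_factorsThrough (μ := μ) (hH n) (hZ n)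
      have hZY : Integrable (fun ω' => Z (n + 1) ω' + Y n ω') μ :=
        (integrable_of_factorsThrough (hH _) (hZ _)).add
          (integrable_of_factorsThrough (hH _) (hY n))
      have h2 : ∀ ω', W (n + 1) ω' =
          (Z (n + 1) ω' + Y n ω') + ∑ i ∈ Finset.range n, Y i ω' := by
        intro ω'
        simp only [W, Finset.sum_range_succ]; ring
      simp_rw [h2]
      simp only [W]
      rw [integral_add hZY.integrableOn hS.integrableOn,
        integral_add hZn.integrableOn hS.integrableOn]
      linarith
  filter_upwards [Supermartingale.ae_tendsto_of_nonneg hW fun n ω =>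
    add_nonneg (hZ0 n ω) (Finset.sum_nonneg fun i _ => hY0 i ω)] with ω hω
  obtain ⟨l, hl⟩ := hω
  exact tendsto_zero_of_add_sum_tendsto (fun n => hZ0 n ω) (fun n => hY0 n ω) hl

/-- The integral over a set that is partitioned by a random variable with finitely many values. -/
theorem setIntegral_eq_sum_of_partition {Ω κ : Type*} {m : MeasurableSpace Ω} {μ : Measure Ω}
    [IsFiniteMeasure μ] [Fintype κ] {A : Set Ω} {T : Ω → κ}
    (hT : ∀ k, MeasurableSet (A ∩ T ⁻¹' {k})) {φ : Ω → ℝ} (hφ : Integrable φ μ) {ψ : κ → ℝ}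
    (h : ∀ ω ∈ A, φ ω = ψ (T ω)) :
    ∫ ω in A, φ ω ∂μ = ∑ k, μ.real (A ∩ T ⁻¹' {k}) * ψ k := by
  have hA : A = ⋃ k, A ∩ T ⁻¹' {k} := by
    ext ω; simp
  conv_lhs => rw [hA]
  rw [integral_iUnion_fintype hT _ fun k => hφ.integrableOn]
  · refine Finset.sum_congr rfl fun k _ => ?_
    rw [setIntegral_congr_fun (hT k) (g := fun _ => ψ k), setIntegral_const, smul_eq_mul]
    rintro ω ⟨hω, hk⟩
    rw [h ω hω, show T ω = k from hk]
  · intro k k' hne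
    exact (Disjoint.preimage _ (by simpa using hne)).mono Set.inter_subset_right
      Set.inter_subset_right

section Run

variable {X : Type*} [NormedAddCommGroup X] [NormedSpace ℝ X] {Ω : Type*} {m : MeasurableSpace Ω}
  {μ : Measure Ω} {ℱ : Filtration ℕ m} {M b : ℕ} {K : Set X} {g f : X → EReal}
  {F : X → StrongDual ℝ X} {Fξ : Fin M → X → StrongDual ℝ X} {Q : X → X → PMF (Fin M)}
  {p γ α : ℝ} {x₀ : X} {ξ : ℕ → Fin b → Ω → Fin M} {coin : ℕ → Ω → Bool} {x w : ℕ → Ω → X}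

theorem IsAlgorithmRun.isStep [FiniteDimensional ℝ X] (hb : 1 ≤ b) (hg : IsProperConvexLSC K g)
    (hf : IsDistanceGenerating (effDomain K g) f) (hα : 0 < α)
    (hx₀ : x₀ ∈ effDomain K g ∩ domSubdiff f)
    (h : IsAlgorithmRun μ ℱ K g f F Fξ Q p γ α x₀ ξ coin x w) (s : ℕ) (ω : Ω) :
    IsStep K g f F α γ (x s ω) (x (s - 1) ω) (w s ω)
      (batchDiff Fξ (fun j => ξ s j ω) (x s ω) (w (s - 1) ω)) (x (s + 1) ω) := by
  obtain ⟨xbar, -, h2, h3⟩ := h.x_succ s ω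
  have := h3.isProxPoint hg hf ⟨x₀, hx₀⟩ hα
  rwa [h2, batchEstimator_eq hb] at this

theorem IsAlgorithmRun.x_mem [FiniteDimensional ℝ X] (hb : 1 ≤ b) (hg : IsProperConvexLSC K g)
    (hf : IsDistanceGenerating (effDomain K g) f) (hα : 0 < α)
    (hx₀ : x₀ ∈ effDomain K g ∩ domSubdiff f)
    (h : IsAlgorithmRun μ ℱ K g f F Fξ Q p γ α x₀ ξ coin x w) (s : ℕ) (ω : Ω) :
    x s ω ∈ effDomain K g ∩ domSubdiff f := by
  cases s with
  | zero => rwa [h.x_zero]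
  | succ s =>
    have := h.isStep hb hg hf hα hx₀ s ω
    exact ⟨this.1, this.2.1⟩

theorem IsAlgorithmRun.w_mem [FiniteDimensional ℝ X] (hb : 1 ≤ b) (hg : IsProperConvexLSC K g)
    (hf : IsDistanceGenerating (effDomain K g) f) (hα : 0 < α)
    (hx₀ : x₀ ∈ effDomain K g ∩ domSubdiff f)
    (h : IsAlgorithmRun μ ℱ K g f F Fξ Q p γ α x₀ ξ coin x w) (s : ℕ) (ω : Ω) :
    w s ω ∈ effDomain K g ∩ domSubdiff f := by
  cases s with
  | zero => rwa [h.w_zero]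
  | succ s =>
    rw [h.w_succ]
    split_ifs <;> exact h.x_mem hb hg hf hα hx₀ _ ω

/-- The iterates are determined by the past coins and samples. -/
theorem IsAlgorithmRun.eq_of_past_eq [FiniteDimensional ℝ X] (hb : 1 ≤ b)
    (hg : IsProperConvexLSC K g) (hf : IsDistanceGenerating (effDomain K g) f) (hα : 0 < α)
    (hx₀ : x₀ ∈ effDomain K g ∩ domSubdiff f)
    (h : IsAlgorithmRun μ ℱ K g f F Fξ Q p γ α x₀ ξ coin x w) {ω ω' : Ω} :
    ∀ n, (∀ i < n, coin i ω = coin i ω') → (∀ i < n, ∀ j, ξ i j ω = ξ i j ω') →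
      ∀ k ≤ n, x k ω = x k ω' ∧ w k ω = w k ω' := by
  have hnext : ∀ s, x s ω = x s ω' → x (s - 1) ω = x (s - 1) ω' → w s ω = w s ω' →
      w (s - 1) ω = w (s - 1) ω' → (∀ j, ξ s j ω = ξ s j ω') → x (s + 1) ω = x (s + 1) ω' := by
    intro s h1 h2 h3 h4 h5
    have e1 := h.isStep hb hg hf hα hx₀ s ω
    have e2 := h.isStep hb hg hf hα hx₀ s ω'
    rw [h1, h2, h3, h4, funext h5] at e1
    have := hf.norm_sub_le_of_isProxPoint e1 e2
    rw [sub_self, norm_zero] at this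
    exact sub_eq_zero.1 (norm_le_zero_iff.1 this)
  intro n
  induction n with
  | zero =>
    intro _ _ k hk
    obtain rfl := Nat.le_zero.1 hk
    simp [h.x_zero, h.w_zero]
  | succ n ih =>
    intro hc hξ k hk
    have ih' := ih (fun i hi => hc i (hi.trans n.lt_succ_self))
      (fun i hi => hξ i (hi.trans n.lt_succ_self))
    rcases Nat.lt_or_ge n k with hnk | hnk
    · obtain rfl : k = n + 1 := by omega
      have hx : x (n + 1) ω = x (n + 1) ω' :=
        hnext n (ih' n le_rfl).1 (ih' _ (Nat.sub_le n 1)).1 (ih' n le_rfl).2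
          (ih' _ (Nat.sub_le n 1)).2 (hξ n n.lt_succ_self)
      refine ⟨hx, ?_⟩
      rw [h.w_succ, h.w_succ, hc n n.lt_succ_self, hx, (ih' n le_rfl).1]
    · exact ih' k hnk

theorem IsAlgorithmRun.measurableSet_coin
    (h : IsAlgorithmRun μ ℱ K g f F Fξ Q p γ α x₀ ξ coin x w) {i n : ℕ} (hi : i < n) (c : Bool) :
    MeasurableSet[ℱ n] {ω | coin i ω = c} :=
  ℱ.mono hi _ (h.measurable_coin i (measurableSet_singleton c))

theorem IsAlgorithmRun.measurableSet_ξ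
    (h : IsAlgorithmRun μ ℱ K g f F Fξ Q p γ α x₀ ξ coin x w) {i n : ℕ} (hi : i < n)
    (J : Fin b → Fin M) : MeasurableSet[ℱ n] {ω | ∀ j, ξ i j ω = J j} := by
  have : {ω | ∀ j, ξ i j ω = J j} = ⋂ j, ξ i j ⁻¹' {J j} := by ext; simp
  rw [this]
  exact MeasurableSet.iInter fun j => ℱ.mono hi _ (h.measurable_ξ i j (measurableSet_singleton _))

theorem IsAlgorithmRun.measureReal_inter [IsProbabilityMeasure μ]
    (h : IsAlgorithmRun μ ℱ K g f F Fξ Q p γ α x₀ ξ coin x w) {s : ℕ} {B : Set Ω}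
    (hB : MeasurableSet[ℱ s] B) (J : Fin b → Fin M) (c : Bool) :
    μ.real (B ∩ {ω | (∀ j, ξ s j ω = J j) ∧ coin s ω = c}) =
      (∫ ω in B, ∏ j, (Q (x s ω) (w (s - 1) ω) (J j)).toReal ∂μ) * (if c then p else 1 - p) := by
  have hE : MeasurableSet {ω | (∀ j, ξ s j ω = J j) ∧ coin s ω = c} := by
    exact ℱ.le (s + 1) _ ((h.measurableSet_ξ s.lt_succ_self J).inter
      (h.measurableSet_coin s.lt_succ_self c))
  have h1 := setIntegral_condExp (μ := μ) (ℱ.le s)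
    ((integrable_const (1 : ℝ)).indicator hE) hB
  rw [setIntegral_congr_ae (ℱ.le s _ hB) ((h.sampling s J c).mono fun ω hω _ => hω),
    integral_mul_const, setIntegral_indicator hE, setIntegral_const, smul_eq_mul, mul_one] at h1
  exact h1.symm

/-- The coins before iteration `n` and the samples up to iteration `n`. -/
def history (ξ : ℕ → Fin b → Ω → Fin M) (coin : ℕ → Ω → Bool) (n : ℕ) (ω : Ω) :
    (Fin n → Bool) × (Fin (n + 1) → Fin b → Fin M) :=
  (fun i => coin i ω, fun i j => ξ i j ω)

theorem history_eq_iff {n : ℕ} {ω ω' : Ω} : history ξ coin n ω = history ξ coin n ω' ↔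
    (∀ i < n, coin i ω = coin i ω') ∧ ∀ i ≤ n, ∀ j, ξ i j ω = ξ i j ω' := by
  simp only [history, Prod.mk.injEq, funext_iff, Fin.forall_iff, Nat.lt_succ_iff]

theorem history_factorsThrough (n : ℕ) :
    (history ξ coin n).FactorsThrough (history ξ coin (n + 1)) := by
  intro ω ω' h
  rw [history_eq_iff] at h ⊢
  exact ⟨fun i hi => h.1 i (by omega), fun i hi => h.2 i (by omega)⟩

/-- The coins and the samples before iteration `n` take given values. -/
theorem IsAlgorithmRun.measurableSet_past
    (h : IsAlgorithmRun μ ℱ K g f F Fξ Q p γ α x₀ ξ coin x w) (n : ℕ) (c : ℕ → Bool)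
    (J : ℕ → Fin b → Fin M) :
    MeasurableSet[ℱ n] {ω | (∀ i < n, coin i ω = c i) ∧ ∀ i < n, ∀ j, ξ i j ω = J i j} := by
  have : {ω | (∀ i < n, coin i ω = c i) ∧ ∀ i < n, ∀ j, ξ i j ω = J i j} =
      (⋂ i ∈ Finset.range n, {ω | coin i ω = c i}) ∩
        ⋂ i ∈ Finset.range n, {ω | ∀ j, ξ i j ω = J i j} := by
    ext; simp
  rw [this]
  exact (Finset.measurableSet_biInter _ fun i hi =>
      h.measurableSet_coin (Finset.mem_range.1 hi) _).inter
    (Finset.measurableSet_biInter _ fun i hi => h.measurableSet_ξ (Finset.mem_range.1 hi) _)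

theorem IsAlgorithmRun.measurableSet_history
    (h : IsAlgorithmRun μ ℱ K g f F Fξ Q p γ α x₀ ξ coin x w) (n : ℕ)
    (s : (Fin n → Bool) × (Fin (n + 1) → Fin b → Fin M)) :
    MeasurableSet[ℱ (n + 1)] (history ξ coin n ⁻¹' {s}) := by
  rcases (history ξ coin n ⁻¹' {s}).eq_empty_or_nonempty with he | ⟨ω₀, hω₀⟩
  · rw [he]; exact @MeasurableSet.empty _ (ℱ (n + 1))
  · obtain rfl : history ξ coin n ω₀ = s := hω₀
    have : history ξ coin n ⁻¹' {history ξ coin n ω₀} =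
        {ω | (∀ i < n, coin i ω = coin i ω₀) ∧ ∀ i < n, ∀ j, ξ i j ω = ξ i j ω₀} ∩
          {ω | ∀ j, ξ n j ω = ξ n j ω₀} := by
      ext ω
      rw [Set.mem_preimage, Set.mem_singleton_iff, history_eq_iff]
      simp only [Set.mem_inter_iff, Set.mem_ofPred_eq, and_assoc, le_iff_lt_or_eq, or_imp,
        forall_and, forall_eq]
    rw [this]
    exact (ℱ.mono n.le_succ _ (h.measurableSet_past n (fun i => coin i ω₀)
      (fun i j => ξ i j ω₀))).inter (h.measurableSet_ξ n.lt_succ_self _)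

theorem IsAlgorithmRun.eq_of_history_eq [FiniteDimensional ℝ X] (hb : 1 ≤ b)
    (hg : IsProperConvexLSC K g) (hf : IsDistanceGenerating (effDomain K g) f) (hα : 0 < α)
    (hx₀ : x₀ ∈ effDomain K g ∩ domSubdiff f)
    (h : IsAlgorithmRun μ ℱ K g f F Fξ Q p γ α x₀ ξ coin x w) {n : ℕ} {ω ω' : Ω}
    (hω : history ξ coin n ω = history ξ coin n ω') :
    x (n + 1) ω = x (n + 1) ω' ∧ x n ω = x n ω' ∧ w n ω = w n ω' := by
  obtain ⟨e1, e2⟩ := history_eq_iff.1 hω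
  have e3 := h.eq_of_past_eq hb hg hf hα hx₀ n e1 fun i hi => e2 i hi.le
  have s1 := h.isStep hb hg hf hα hx₀ n ω
  have s2 := h.isStep hb hg hf hα hx₀ n ω'
  rw [(e3 n le_rfl).1, (e3 n le_rfl).2, (e3 _ (Nat.sub_le n 1)).1, (e3 _ (Nat.sub_le n 1)).2,
    funext (e2 n le_rfl)] at s1
  have := hf.norm_sub_le_of_isProxPoint s1 s2
  rw [sub_self, norm_zero] at this
  exact ⟨sub_eq_zero.1 (norm_le_zero_iff.1 this), e3 n le_rfl⟩

/-- Given the history, the next coin and the next batch are drawn independently. -/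
theorem IsAlgorithmRun.measureReal_history_inter [FiniteDimensional ℝ X] [IsProbabilityMeasure μ]
    (hb : 1 ≤ b)
    (hg : IsProperConvexLSC K g) (hf : IsDistanceGenerating (effDomain K g) f) (hα : 0 < α)
    (hx₀ : x₀ ∈ effDomain K g ∩ domSubdiff f)
    (h : IsAlgorithmRun μ ℱ K g f F Fξ Q p γ α x₀ ξ coin x w) (n : ℕ) (ω₀ : Ω) (c : Bool)
    (J : Fin b → Fin M) :
    μ.real (history ξ coin n ⁻¹' {history ξ coin n ω₀} ∩
        (fun ω => ((fun j => ξ (n + 1) j ω : Fin b → Fin M), coin n ω)) ⁻¹' {(J, c)}) =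
      μ.real (history ξ coin n ⁻¹' {history ξ coin n ω₀}) *
        ((∏ j, (Q (x (n + 1) ω₀) (w n ω₀) (J j)).toReal) * (if c then p else 1 - p)) := by
  set A := history ξ coin n ⁻¹' {history ξ coin n ω₀} with hA
  have hAm : MeasurableSet[ℱ (n + 1)] A := h.measurableSet_history n _
  have htotal : ∀ s : ℕ, ∀ J : Fin b → Fin M, ∀ B : Set Ω, MeasurableSet[ℱ s] B →
      μ.real (B ∩ {ω | ∀ j, ξ s j ω = J j}) =
        ∫ ω in B, ∏ j, (Q (x s ω) (w (s - 1) ω) (J j)).toReal ∂μ := by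
    intro s J B hB
    have e1 := h.measureReal_inter hB J true
    have e2 := h.measureReal_inter hB J false
    have e3 := measureReal_inter_add_sdiff (μ := μ) (s := B ∩ {ω | ∀ j, ξ s j ω = J j})
      (ℱ.le _ _ (h.measurableSet_coin s.lt_succ_self true))
    have e4 : B ∩ {ω | ∀ j, ξ s j ω = J j} ∩ {ω | coin s ω = true} =
        B ∩ {ω | (∀ j, ξ s j ω = J j) ∧ coin s ω = true} := by
      ext; simp [and_assoc]
    have e5 : (B ∩ {ω | ∀ j, ξ s j ω = J j}) \ {ω | coin s ω = true} =
        B ∩ {ω | (∀ j, ξ s j ω = J j) ∧ coin s ω = false} := by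
      ext; simp [and_assoc]
    rw [e4, e5, e1, e2] at e3
    simp only [if_true, Bool.false_eq_true, if_false] at e3
    linarith
  have hstate : ∀ ω ∈ A, x (n + 1) ω = x (n + 1) ω₀ ∧ w n ω = w n ω₀ := fun ω hω =>
    have e := h.eq_of_history_eq hb hg hf hα hx₀ hω
    ⟨e.1, e.2.2⟩
  have hcoin : μ.real (A ∩ {ω | coin n ω = c}) = μ.real A * (if c then p else 1 - p) := by
    let B : Set Ω := {ω | (∀ i < n, coin i ω = coin i ω₀) ∧ ∀ i < n, ∀ j, ξ i j ω = ξ i j ω₀}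
    have hB : MeasurableSet[ℱ n] B :=
      h.measurableSet_past n (fun i => coin i ω₀) (fun i j => ξ i j ω₀)
    have hAB : A = B ∩ {ω | ∀ j, ξ n j ω = ξ n j ω₀} := by
      ext ω
      rw [hA, Set.mem_preimage, Set.mem_singleton_iff, history_eq_iff]
      simp only [B, Set.mem_inter_iff, Set.mem_ofPred_eq, and_assoc, le_iff_lt_or_eq, or_imp,
        forall_and, forall_eq]
    rw [hAB, htotal n _ B hB, ← h.measureReal_inter hB (fun j => ξ n j ω₀) c]
    congr 1
    ext; simp [and_assoc]
  have h1 : A ∩ (fun ω => ((fun j => ξ (n + 1) j ω : Fin b → Fin M), coin n ω)) ⁻¹' {(J, c)} =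
      (A ∩ {ω | coin n ω = c}) ∩ {ω | ∀ j, ξ (n + 1) j ω = J j} := by
    ext ω
    simp only [Set.mem_inter_iff, Set.mem_preimage, Set.mem_singleton_iff, Prod.mk.injEq,
      funext_iff, Set.mem_ofPred_eq]
    tauto
  have hAc : MeasurableSet[ℱ (n + 1)] (A ∩ {ω | coin n ω = c}) :=
    hAm.inter (h.measurableSet_coin n.lt_succ_self c)
  rw [h1, htotal (n + 1) J _ hAc, setIntegral_congr_fun (ℱ.le _ _ hAc)
    (g := fun _ => ∏ j, (Q (x (n + 1) ω₀) (w n ω₀) (J j)).toReal), setIntegral_const, hcoin,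
    smul_eq_mul]
  · ring
  · intro ω hω
    simp only [Nat.add_sub_cancel]
    rw [(hstate ω hω.1).1, (hstate ω hω.1).2]

/-- Almost surely the Lyapunov function of a given solution converges, and the steps and the
sampled differences tend to zero. -/
theorem IsAlgorithmRun.ae_tendsto_lyapunov [FiniteDimensional ℝ X] [IsProbabilityMeasure μ]
    (hb : 1 ≤ b) (hg : IsProperConvexLSC K g)
    (hf : IsDistanceGenerating (effDomain K g) f) (hF : IsMonotoneOn (effDomain K g) F)
    {Lbar c : ℝ} (ho : IsVariableLipschitzOracle (effDomain K g) F Fξ Q Lbar)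
    (hα : 0 < α) (hα1 : α ≤ 1 - c) (hc0 : 0 < c) (hLc : Lbar ^ 2 < c) (hp0 : 0 < p) (hp1 : p < 1)
    (hγ : γ = 1 - c * (1 - p)) (hx₀ : x₀ ∈ effDomain K g ∩ domSubdiff f)
    (h : IsAlgorithmRun μ ℱ K g f F Fξ Q p γ α x₀ ξ coin x w) {u : X}
    (hu : u ∈ solutionSet K g F) :
    ∀ᵐ ω ∂μ,
      (∃ l, Tendsto (fun n => lyapunov f F u α p c (x (n + 1) ω) (x n ω) (w n ω)) atTop (𝓝 l)) ∧
      Tendsto (fun n => x (n + 2) ω - x (n + 1) ω) atTop (𝓝 0) ∧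
      Tendsto (fun n => batchDiff Fξ (fun j => ξ (n + 1) j ω) (x (n + 1) ω) (w n ω))
        atTop (𝓝 0) := by
  subst hγ
  have hc1 : c < 1 := by linarith
  have hl : 0 < anchorWeight c := by
    have : 0 < 2 - c := by linarith
    unfold anchorWeight; positivity
  obtain ⟨ε, hε0, hε1, hε2⟩ : ∃ ε, 0 < ε ∧ ε ≤ p * c ^ 2 / 2 ∧
      (anchorWeight c / c + ε) * Lbar ^ 2 ≤ anchorWeight c := by
    have h1 : 0 < anchorWeight c * (c - Lbar ^ 2) / c ^ 2 := by
      have := sub_pos.2 hLc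
      positivity
    refine ⟨min (p * c ^ 2 / 2) (anchorWeight c * (c - Lbar ^ 2) / c ^ 2),
      lt_min (by positivity) h1, min_le_left _ _, ?_⟩
    calc _ ≤ anchorWeight c / c * Lbar ^ 2 + anchorWeight c * (c - Lbar ^ 2) / c ^ 2 * c := by
          rw [add_mul]
          gcongr
          exact min_le_right _ _
      _ = _ := by field_simp; ring
  have hxm := h.x_mem hb hg hf hα hx₀
  have hwm := h.w_mem hb hg hf hα hx₀
  have hdet := @IsAlgorithmRun.eq_of_history_eq _ _ _ _ _ _ _ _ _ _ _ _ _ _ _ _ _ _ _ _ _ _ _ _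
    hb hg hf hα hx₀ h
  let Z : ℕ → Ω → ℝ := fun n ω => lyapunov f F u α p c (x (n + 1) ω) (x n ω) (w n ω)
  let η : ℕ → Ω → StrongDual ℝ X := fun n ω =>
    batchDiff Fξ (fun j => ξ (n + 1) j ω) (x (n + 1) ω) (w n ω)
  let Y : ℕ → Ω → ℝ := fun n ω => ε * (‖x (n + 2) ω - x (n + 1) ω‖ ^ 2 + ‖η n ω‖ ^ 2)
  have hZf : ∀ n, (Z n).FactorsThrough (history ξ coin n) := by
    intro n ω ω' hω
    obtain ⟨e1, e2, e3⟩ := hdet hω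
    simp only [Z, e1, e2, e3]
  have hYf : ∀ n, (Y n).FactorsThrough (history ξ coin (n + 1)) := by
    intro n ω ω' hω
    obtain ⟨e1, e2, -⟩ := hdet hω
    obtain ⟨-, -, e3⟩ := hdet (history_factorsThrough n hω)
    have e4 := funext ((history_eq_iff.1 hω).2 (n + 1) le_rfl)
    simp only [Y, η, e1, e2, e3, e4]
  have hH : ∀ n s, MeasurableSet (history ξ coin n ⁻¹' {s}) :=
    fun n s => ℱ.le _ _ (h.measurableSet_history n s)
  have hle : ∀ n ω,
      ∫ ω' in history ξ coin n ⁻¹' {history ξ coin n ω}, (Z (n + 1) ω' + Y n ω') ∂μ ≤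
      ∫ ω' in history ξ coin n ⁻¹' {history ξ coin n ω}, Z n ω' ∂μ := by
    intro n ω₀
    set A := history ξ coin n ⁻¹' {history ξ coin n ω₀} with hA
    by_cases hμA : μ.real A = 0
    · have : μ.restrict A = 0 := by
        rw [Measure.restrict_eq_zero]
        exact (measureReal_eq_zero_iff).1 hμA
      simp [this]
    let T : Ω → (Fin b → Fin M) × Bool := fun ω => (fun j => ξ (n + 1) j ω, coin n ω)
    have hprob : ∀ c J, μ.real (A ∩ T ⁻¹' {(J, c)}) = μ.real A *
        ((∏ j, (Q (x (n + 1) ω₀) (w n ω₀) (J j)).toReal) * (if c then p else 1 - p)) :=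
      h.measureReal_history_inter hb hg hf hα hx₀ n ω₀
    have hAT : ∀ ω ∈ A, ∀ ω' ∈ A, T ω = T ω' →
        history ξ coin (n + 1) ω = history ξ coin (n + 1) ω' := by
      intro ω hω ω' hω' hT
      have e1 := history_eq_iff.1
        ((show history ξ coin n ω = _ from hω).trans (show history ξ coin n ω' = _ from hω').symm)
      rw [Prod.mk.injEq] at hT
      refine history_eq_iff.2 ⟨fun i hi => ?_, fun i hi => ?_⟩
      · rcases Nat.lt_succ_iff_lt_or_eq.1 hi with hi | rfl
        · exact e1.1 i hi
        · exact hT.2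
      · rcases Nat.le_succ_iff.1 hi with hi | rfl
        · exact e1.2 i hi
        · exact congrFun hT.1
    classical
    let z : Bool → (Fin b → Fin M) → X := fun c J =>
      if hc : ∃ ω ∈ A, T ω = (J, c) then x (n + 2) hc.choose else x₀
    have hz : ∀ ω ∈ A, x (n + 2) ω = z (T ω).2 (T ω).1 := by
      intro ω hω
      have hc : ∃ ω' ∈ A, T ω' = ((T ω).1, (T ω).2) := ⟨ω, hω, rfl⟩
      simp only [z, dif_pos hc]
      exact (hdet (hAT ω hω _ hc.choose_spec.1 hc.choose_spec.2.symm)).1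
    have hAm : ∀ k, MeasurableSet (A ∩ T ⁻¹' {k}) := by
      rintro ⟨J, c⟩
      have : A ∩ T ⁻¹' {(J, c)} = A ∩ ({ω | ∀ j, ξ (n + 1) j ω = J j} ∩ {ω | coin n ω = c}) := by
        ext ω
        simp only [T, Set.mem_inter_iff, Set.mem_preimage, Set.mem_singleton_iff, Prod.mk.injEq,
          funext_iff, Set.mem_ofPred_eq]
      rw [this]
      exact (hH n _).inter (ℱ.le (n + 2) _ ((h.measurableSet_ξ (by omega) J).inter
        (h.measurableSet_coin (by omega) c)))
    rw [setIntegral_eq_sum_of_partition (T := T) hAm (φ := fun ω => Z (n + 1) ω + Y n ω)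
      ((integrable_of_factorsThrough (hH _) (hZf (n + 1))).add
        (integrable_of_factorsThrough (hH _) (hYf n)))
      (ψ := fun k => lyapunov f F u α p c (z k.2 k.1) (x (n + 1) ω₀)
          (if k.2 then x (n + 1) ω₀ else x n ω₀)
        + ε * (‖z k.2 k.1 - x (n + 1) ω₀‖ ^ 2
          + ‖batchDiff Fξ k.1 (x (n + 1) ω₀) (w n ω₀)‖ ^ 2)),
      setIntegral_congr_fun (hH n _) (g := fun _ => Z n ω₀) fun ω hω => hZf n hω,
      setIntegral_const, smul_eq_mul, Fintype.sum_prod_type]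
    · refine le_of_eq_of_le ?_ (mul_le_mul_of_nonneg_left
        (sum_lyapunov_le hb (z := z) hg hf hF ho hα hα1 hc0 hLc.le hp0 hp1 hε0.le hε1 hε2
          (hxm (n + 1) ω₀) (hxm n ω₀) (hwm n ω₀).1 hu ?_) measureReal_nonneg)
      · simp only [← hA, hprob, Finset.mul_sum, mul_assoc]
      · intro c J hJ
        have hne : (A ∩ T ⁻¹' {(J, c)}).Nonempty := by
          by_contra hemp
          rw [Set.not_nonempty_iff_eq_empty] at hemp
          have e := hprob c J
          rw [hemp, measureReal_empty] at e
          have hpc : (if c then p else 1 - p) ≠ 0 := by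
            split_ifs
            · exact hp0.ne'
            · exact (sub_pos.2 hp1).ne'
          exact mul_ne_zero hμA (mul_ne_zero hJ hpc) e.symm
        obtain ⟨ω, hω, hT⟩ := hne
        have hT' : T ω = (J, c) := hT
        have e1 := h.isStep hb hg hf hα hx₀ (n + 1) ω
        obtain ⟨e2, e3, e4⟩ := hdet (show history ξ coin n ω = _ from hω)
        have e5 := hz ω hω
        have e6 : (fun j => ξ (n + 1) j ω) = J := congrArg Prod.fst hT'
        have e7 : coin n ω = c := congrArg Prod.snd hT'
        rw [hT'] at e5
        rw [h.w_succ, Nat.add_sub_cancel, e2, e3, e4, e6, e7, e5] at e1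
        exact e1
    · intro ω hω
      obtain ⟨e2, e3, e4⟩ := hdet (show history ξ coin n ω = _ from hω)
      have e5 := hz ω hω
      simp only [Z, Y, η]
      rw [h.w_succ, show n + 1 + 1 = n + 2 from rfl, e2, e3, e4, e5]
  have hLc' : ∀ n ω, ‖F (x (n + 1) ω) - F (w n ω)‖ ^ 2 ≤ c * ‖x (n + 1) ω - w n ω‖ ^ 2 :=
    fun n ω => (ho.norm_sub_sq_le (hxm _ _).1 (hwm _ _).1).trans (by gcongr)
  filter_upwards [ae_tendsto_of_setIntegral_fiber_le hH history_factorsThrough hZf hYf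
    (fun n ω => lyapunov_nonneg hf hα hα1 hc0 hp1 (hxm _ _).2 (hxm _ _).2 (hLc' n ω) hu.1)
    (fun n ω => by positivity) hle] with ω hω
  refine ⟨hω.1, ?_⟩
  have hY := hω.2.const_mul ε⁻¹
  simp only [Y, inv_mul_cancel_left₀ hε0.ne', mul_zero] at hY
  have hsq : ∀ a : ℕ → ℝ, (∀ n, 0 ≤ a n) → Tendsto (fun n => a n ^ 2) atTop (𝓝 0) →
      Tendsto a atTop (𝓝 0) := by
    intro a ha h0
    simpa [Real.sqrt_sq (ha _)] using h0.sqrt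
  constructor
  · refine tendsto_zero_iff_norm_tendsto_zero.2 (hsq _ (fun n => norm_nonneg _) ?_)
    exact squeeze_zero (fun n => sq_nonneg _)
      (fun n => le_add_of_nonneg_right (sq_nonneg ‖η n ω‖)) hY
  · refine tendsto_zero_iff_norm_tendsto_zero.2 (hsq _ (fun n => norm_nonneg _) ?_)
    exact squeeze_zero (fun n => sq_nonneg _)
      (fun n => le_add_of_nonneg_left (sq_nonneg ‖x (n + 2) ω - x (n + 1) ω‖)) hY

end Run

section Limit

variable {X : Type*} [NormedAddCommGroup X] [NormedSpace ℝ X] {K : Set X} {g f : X → EReal}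
  {F : X → StrongDual ℝ X}

theorem le_of_tendsto_of_toReal_le (hg : IsProperConvexLSC K g) (hK : IsClosed K) {z : ℕ → X}
    {y : X} (hz : ∀ n, z n ∈ effDomain K g) (hzy : Tendsto z atTop (𝓝 y)) {r : ℕ → ℝ} {r₀ : ℝ}
    (hr : Tendsto r atTop (𝓝 r₀)) (hle : ∀ n, (g (z n)).toReal ≤ r n) :
    y ∈ K ∧ g y ≤ r₀ := by
  have hy : y ∈ K := hK.mem_of_tendsto hzy (Eventually.of_forall fun n => (hz n).1)
  refine ⟨hy, le_of_forall_lt fun a ha => ?_⟩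
  obtain ⟨a', ha1, ha2⟩ := EReal.lt_iff_exists_real_btwn.1 ha
  have h1 : Tendsto z atTop (𝓝[K] y) :=
    tendsto_nhdsWithin_iff.2 ⟨hzy, Eventually.of_forall fun n => (hz n).1⟩
  refine ha1.trans_le (EReal.coe_le_coe_iff.2 (ge_of_tendsto hr ?_))
  filter_upwards [h1.eventually (hg.lsc y hy _ ha2)] with n hn
  rw [gt_iff_lt, ← coe_toReal_of_mem_effDomain hg (hz n), EReal.coe_lt_coe_iff] at hn
  exact hn.le.trans (hle n)

theorem tendsto_dual_apply {v : ℕ → StrongDual ℝ X} {v₀ : StrongDual ℝ X} {y : ℕ → X} {y₀ : X}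
    (hv : Tendsto v atTop (𝓝 v₀)) (hy : Tendsto y atTop (𝓝 y₀)) :
    Tendsto (fun n => v n (y n)) atTop (𝓝 (v₀ y₀)) :=
  (isBoundedBilinearMap_apply.continuous.tendsto (v₀, y₀)).comp (hv.prodMk_nhds hy)

/-- If consecutive iterates converge to a point of `dom ∂f` and the sampling noise vanishes, the
limit solves the variational inequality. -/
theorem mem_solutionSet_of_tendsto (hK : IsClosed K) (hg : IsProperConvexLSC K g)
    (hf_cont : ContinuousOn (grad f) (domSubdiff f)) {L : ℝ}
    (hF : IsLipschitzOn (effDomain K g) F L) {α γ : ℝ} (hα : 0 < α)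
    (hG : (effDomain K g).Nonempty) {x x' w z : ℕ → X}
    {η : ℕ → StrongDual ℝ X} {y : X} (hy : y ∈ domSubdiff f)
    (hxm : ∀ n, x n ∈ domSubdiff f) (hxm' : ∀ n, x' n ∈ domSubdiff f)
    (hwm : ∀ n, w n ∈ effDomain K g)
    (hstep : ∀ n, IsStep K g f F α γ (x n) (x' n) (w n) (η n) (z n))
    (hx : Tendsto x atTop (𝓝 y)) (hx' : Tendsto x' atTop (𝓝 y)) (hw : Tendsto w atTop (𝓝 y))
    (hz : Tendsto z atTop (𝓝 y)) (hη : Tendsto η atTop (𝓝 0)) : y ∈ solutionSet K g F := by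
  have hgrad : ∀ s : ℕ → X, (∀ n, s n ∈ domSubdiff f) → Tendsto s atTop (𝓝 y) →
      Tendsto (fun n => grad f (s n)) atTop (𝓝 (grad f y)) := fun s hs hsy =>
    (hf_cont y hy).tendsto.comp (tendsto_nhdsWithin_iff.2 ⟨hsy, Eventually.of_forall hs⟩)
  let v : ℕ → StrongDual ℝ X := fun n =>
    grad f (z n) - (γ • grad f (x n) + (1 - γ) • grad f (x' n)) + α • η n
  have hv : Tendsto v atTop (𝓝 0) := by
    have := ((hgrad z (fun n => (hstep n).2.1) hz).sub (((hgrad x hxm hx).const_smul γ).add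
      ((hgrad x' hxm' hx').const_smul (1 - γ)))).add (hη.const_smul α)
    convert this using 2
    rw [smul_zero, add_zero, ← add_smul]
    simp
  have hopt : ∀ u ∈ effDomain K g, ∀ n,
      (g (z n)).toReal ≤ (g u).toReal + α⁻¹ * v n (u - z n) + F (w n) (u - z n) := by
    intro u hu n
    have h1 := (hstep n).2.2 u hu
    have h2 : α * ((g u).toReal + α⁻¹ * v n (u - z n) + F (w n) (u - z n)) =
        α * (g u).toReal + v n (u - z n) + α * F (w n) (u - z n) := by
      field_simp
    refine le_of_mul_le_mul_left ?_ hα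
    rw [h2]
    simp only [v, sub_apply, add_apply, smul_apply, smul_eq_mul] at h1 ⊢
    linarith
  have hyG : y ∈ effDomain K g := by
    obtain ⟨a, ha⟩ := hG
    have hr : Tendsto (fun n => (g a).toReal + α⁻¹ * v n (a - z n)
        + (‖F a‖ + L * ‖w n - a‖) * ‖a - z n‖) atTop
        (𝓝 ((g a).toReal + α⁻¹ * (0 : StrongDual ℝ X) (a - y)
          + (‖F a‖ + L * ‖y - a‖) * ‖a - y‖)) := by
      have h1 : Tendsto (fun n => a - z n) atTop (𝓝 (a - y)) := hz.const_sub a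
      exact (((tendsto_dual_apply hv h1).const_mul _).const_add _).add
        ((((hw.sub_const a).norm.const_mul L).const_add _).mul h1.norm)
    obtain ⟨h1, h2⟩ := le_of_tendsto_of_toReal_le hg hK (fun n => (hstep n).1) hz hr fun n => by
      refine (hopt a ha n).trans (add_le_add le_rfl ?_)
      refine (le_abs_self _).trans (((F (w n)).le_opNorm _).trans ?_)
      refine mul_le_mul_of_nonneg_right ?_ (norm_nonneg _)
      have h3 := hF (w n) (hwm n) a ha
      have h4 := norm_sub_norm_le (F (w n)) (F a)
      linarith
    exact ⟨h1, h2.trans_lt (EReal.coe_lt_top _)⟩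
  have hFw : Tendsto (fun n => F (w n)) atTop (𝓝 (F y)) := by
    rw [tendsto_iff_norm_sub_tendsto_zero] at hw ⊢
    refine squeeze_zero (fun n => norm_nonneg _) (fun n => hF (w n) (hwm n) y hyG) ?_
    simpa using hw.const_mul L
  refine ⟨hyG, fun u hu => ?_⟩
  by_cases hut : g u = ⊤
  · rw [hut, EReal.coe_add_top]
    exact le_top
  · have huG : u ∈ effDomain K g := ⟨hu, lt_top_iff_ne_top.2 hut⟩
    have h1 : Tendsto (fun n => u - z n) atTop (𝓝 (u - y)) := hz.const_sub u
    have hr := (((tendsto_dual_apply hv h1).const_mul α⁻¹).const_add (g u).toReal).add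
      (tendsto_dual_apply hFw h1)
    have h2 := (le_of_tendsto_of_toReal_le hg hK (fun n => (hstep n).1) hz hr (hopt u huG)).2
    rwa [zero_apply, mul_zero, add_zero, add_comm, EReal.coe_add,
      coe_toReal_of_mem_effDomain hg huG] at h2

theorem le_of_sq_le_add_mul {r A B : ℝ} (hA : 0 ≤ A) (hB : 0 ≤ B) (h : r ^ 2 ≤ A + B * r) :
    r ≤ A + B + 1 := by
  by_contra! hlt
  nlinarith

/-- If the Lyapunov function converges, so does its main part, and the iterates are bounded. -/
theorem tendsto_bregman_of_tendsto_lyapunov (hf : IsDistanceGenerating (effDomain K g) f)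
    {L : ℝ} (hF : IsLipschitzOn (effDomain K g) F L) (hL : 0 ≤ L) {α p c : ℝ} (hα : 0 < α)
    (hc0 : 0 < c) (hc1 : c < 1) (hp1 : p < 1) {x w : ℕ → X} {u : X}
    (hxm : ∀ n, x n ∈ effDomain K g ∩ domSubdiff f) (hwm : ∀ n, w n ∈ effDomain K g)
    (hx : Tendsto (fun n => x (n + 1) - x n) atTop (𝓝 0))
    (hw : Tendsto (fun n => x (n + 1) - w n) atTop (𝓝 0)) (hu : u ∈ effDomain K g) {l : ℝ}
    (hl : Tendsto (fun n => lyapunov f F u α p c (x (n + 1)) (x n) (w n)) atTop (𝓝 l)) :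
    (∃ l', Tendsto (fun n => bregman f u (x (n + 1)) + c * (1 - p) * bregman f u (x n))
      atTop (𝓝 l')) ∧ ∃ R, ∀ n, ‖u - x (n + 1)‖ ≤ R := by
  have hlam : 0 ≤ anchorWeight c := by
    have : 0 < 2 - c := by linarith
    unfold anchorWeight; positivity
  have hE : 0 ≤ stepWeight c := by
    have h5 : 0 < 2 - c := by linarith
    have h6 : 0 < 1 - c := by linarith
    unfold stepWeight; positivity
  obtain ⟨A, hA⟩ := hl.bddAbove_range
  obtain ⟨W, hW⟩ := hw.norm.bddAbove_range
  have hW0 : 0 ≤ W := (norm_nonneg _).trans (hW ⟨0, rfl⟩)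
  have hinner : ∀ n, |(F (x (n + 1)) - F (w n)) (u - x (n + 1))| ≤
      L * ‖x (n + 1) - w n‖ * ‖u - x (n + 1)‖ := fun n =>
    ((F (x (n + 1)) - F (w n)).le_opNorm _).trans
      (mul_le_mul_of_nonneg_right (hF _ (hxm _).1 _ (hwm _)) (norm_nonneg _))
  have hR : ∀ n, ‖u - x (n + 1)‖ ≤ |A| + 2 * α * L * W + 1 := by
    intro n
    refine le_of_sq_le_add_mul (abs_nonneg A) (by positivity) ?_
    have h1 : lyapunov f F u α p c (x (n + 1)) (x n) (w n) ≤ A := hA ⟨n, rfl⟩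
    have h2 := hf.half_sq_le_bregman (hf.subset hu) (hxm (n + 1)).2
    have h3 := (hf.half_sq_le_bregman (hf.subset hu) (hxm n).2).trans' (by positivity)
    have h4 := mul_nonneg (mul_nonneg hc0.le (sub_nonneg.2 hp1.le)) h3
    have h5 := (neg_le_of_abs_le (hinner n))
    have h6 : L * ‖x (n + 1) - w n‖ * ‖u - x (n + 1)‖ ≤ L * W * ‖u - x (n + 1)‖ := by
      gcongr
      exact hW ⟨n, rfl⟩
    have h7 := mul_le_mul_of_nonneg_left (h5.trans' (neg_le_neg h6)) hα.le
    have h8 := mul_nonneg hlam (sq_nonneg ‖x (n + 1) - w n‖)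
    have h9 := mul_nonneg hE (sq_nonneg ‖x (n + 1) - x n‖)
    unfold lyapunov at h1
    linarith [le_abs_self A]
  refine ⟨⟨l / 2, ?_⟩, _, hR⟩
  have h1 : Tendsto (fun n => (F (x (n + 1)) - F (w n)) (u - x (n + 1))) atTop (𝓝 0) := by
    refine squeeze_zero_norm (a := fun n =>
      L * ‖x (n + 1) - w n‖ * (|A| + 2 * α * L * W + 1)) (fun n => ?_) ?_
    · refine (hinner n).trans ?_
      gcongr
      exact hR n
    · simpa using (hw.norm.const_mul L).mul_const (|A| + 2 * α * L * W + 1)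
  have h2 := (((hl.sub (h1.const_mul (2 * α))).sub
    ((hw.norm.pow 2).const_mul (anchorWeight c))).sub
    ((hx.norm.pow 2).const_mul (stepWeight c))).div_const 2
  simp only [norm_zero, ne_eq, OfNat.ofNat_ne_zero, not_false_eq_true, zero_pow, mul_zero,
    sub_zero] at h2
  refine h2.congr fun n => ?_
  unfold lyapunov
  ring

/-- The deterministic part of the convergence proof. -/
theorem exists_tendsto_of_tendsto_lyapunov [FiniteDimensional ℝ X] (hK : IsClosed K)
    (hg : IsProperConvexLSC K g) (hf : IsDistanceGenerating (effDomain K g) f)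
    (hf_cont : ContinuousOn (grad f) (domSubdiff f)) {L : ℝ}
    (hF : IsLipschitzOn (effDomain K g) F L) (hL : 0 ≤ L) {α p c : ℝ} (hα : 0 < α)
    (hc0 : 0 < c) (hc1 : c < 1) (hp0 : 0 < p) (hp1 : p < 1) {x w : ℕ → X} {η : ℕ → StrongDual ℝ X}
    (hxm : ∀ n, x n ∈ effDomain K g ∩ domSubdiff f) (hwm : ∀ n, w n ∈ effDomain K g)
    (hwx : ∀ n, w (n + 1) = x (n + 1) ∨ w (n + 1) = x n)
    (hstep : ∀ n, IsStep K g f F α (1 - c * (1 - p)) (x (n + 1)) (x n) (w (n + 1)) (η n)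
      (x (n + 2)))
    (hd : Tendsto (fun n => x (n + 2) - x (n + 1)) atTop (𝓝 0)) (hη : Tendsto η atTop (𝓝 0))
    {C : Set X} (hC : C ⊆ solutionSet K g F ∩ domSubdiff f) (hCne : C.Nonempty)
    (hCd : solutionSet K g F ∩ domSubdiff f ⊆ closure C)
    (hlim : ∀ u ∈ C, ∃ l,
      Tendsto (fun n => lyapunov f F u α p c (x (n + 1)) (x n) (w n)) atTop (𝓝 l)) :
    ∃ y ∈ solutionSet K g F, Tendsto x atTop (𝓝 y) := by
  have hx : Tendsto (fun n => x (n + 1) - x n) atTop (𝓝 0) := (tendsto_add_atTop_iff_nat 1).1 hd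
  have hxw : Tendsto (fun n => x n - w n) atTop (𝓝 0) := by
    refine (tendsto_add_atTop_iff_nat 1).1 (squeeze_zero_norm (fun n => ?_)
      (tendsto_zero_iff_norm_tendsto_zero.1 hx))
    rcases hwx n with h | h
    · rw [h, sub_self, norm_zero]; exact norm_nonneg _
    · rw [h]
  have hw : Tendsto (fun n => x (n + 1) - w n) atTop (𝓝 0) := by
    simpa using hx.add hxw
  let Φ : X → ℕ → ℝ := fun u n => bregman f u (x (n + 1)) + c * (1 - p) * bregman f u (x n)
  have hcp0 : 0 ≤ c * (1 - p) := mul_nonneg hc0.le (by linarith)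
  have hcp1 : c * (1 - p) ≤ 1 := by nlinarith
  have hD0 : ∀ u ∈ effDomain Set.univ f, ∀ n, 0 ≤ bregman f u (x n) := fun u hu n =>
    (hf.half_sq_le_bregman hu (hxm n).2).trans' (by positivity)
  have hΦlim : ∀ u ∈ C, ∃ l, Tendsto (Φ u) atTop (𝓝 l) := fun u hu => by
    obtain ⟨l, hl⟩ := hlim u hu
    exact (tendsto_bregman_of_tendsto_lyapunov hf hF hL hα hc0 hc1 hp1 hxm hwm hx hw
      (hC hu).1.1 hl).1
  -- boundedness of the iterates and of the gradients
  obtain ⟨u₀, hu₀⟩ := hCne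
  obtain ⟨R, hR⟩ : ∃ R, ∀ n, ‖u₀ - x (n + 1)‖ ≤ R := by
    obtain ⟨l, hl⟩ := hlim u₀ hu₀
    exact (tendsto_bregman_of_tendsto_lyapunov hf hF hL hα hc0 hc1 hp1 hxm hwm hx hw
      (hC hu₀).1.1 hl).2
  obtain ⟨B, hB⟩ : ∃ B, ∀ n, ‖grad f (x (n + 1))‖ ≤ B := by
    obtain ⟨l, hl⟩ := hΦlim u₀ hu₀
    obtain ⟨A, hA⟩ := hl.bddAbove_range
    obtain ⟨B, hB⟩ := hf.exists_norm_grad_le (hC hu₀).2 A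
    refine ⟨B, fun n => hB _ (hxm _).2 (le_trans ?_ (hA ⟨n, rfl⟩))⟩
    exact le_add_of_nonneg_right (mul_nonneg hcp0 (hD0 u₀ (hC hu₀).2.1 n))
  -- a limit point of the iterates
  have : ProperSpace (X × StrongDual ℝ X) := FiniteDimensional.proper ℝ _
  have hbdd : Bornology.IsBounded (Metric.closedBall u₀ R ×ˢ
      Metric.closedBall (0 : StrongDual ℝ X) B) :=
    Metric.isBounded_closedBall.prod Metric.isBounded_closedBall
  obtain ⟨⟨y, v⟩, -, φ, hφ, hlimφ⟩ := tendsto_subseq_of_bounded hbdd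
    (x := fun n => (x (n + 1), grad f (x (n + 1)))) fun n => by
      simpa [dist_eq_norm, norm_sub_rev _ u₀] using ⟨hR n, hB n⟩
  have hy0 : Tendsto (fun j => x (φ j + 1)) atTop (𝓝 y) := (continuous_fst.tendsto _).comp hlimφ
  have hyf : y ∈ domSubdiff f := hf.mem_domSubdiff_of_tendsto (fun n => (hxm _).2) hy0
    ((continuous_snd.tendsto _).comp hlimφ)
  have hshift : ∀ k, Tendsto (fun j => x (φ j + 1 + k)) atTop (𝓝 y) := by
    intro k
    induction k with
    | zero => exact hy0
    | succ k ih =>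
      have h1 : Tendsto (fun j => φ j + 1 + k) atTop atTop :=
        tendsto_atTop_mono (fun j => by omega) hφ.tendsto_atTop
      simpa [add_assoc] using (hx.comp h1).add ih
  have hφ1 : Tendsto (fun j => φ j + 1) atTop atTop :=
    tendsto_atTop_mono (fun j => by omega) hφ.tendsto_atTop
  have hwy : Tendsto (fun j => w (φ j + 1 + 1)) atTop (𝓝 y) := by
    have h1 := (hshift 1).sub (hxw.comp ((tendsto_add_atTop_nat 1).comp hφ1))
    simpa using h1
  have hyS : y ∈ solutionSet K g F :=
    mem_solutionSet_of_tendsto hK hg hf_cont hF hα ⟨_, (hxm 0).1⟩ hyf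
      (fun j => (hxm (φ j + 1 + 1)).2) (fun j => (hxm (φ j + 1)).2)
      (fun j => hwm (φ j + 1 + 1)) (fun j => hstep (φ j + 1)) (hshift 1) hy0 hwy
      (hshift 2) (hη.comp hφ1)
  refine ⟨y, hyS, ?_⟩
  -- the Bregman distance to the limit point tends to zero along the subsequence
  have hcf : ContinuousAt (fun z => (f z).toReal) y := (hf.differentiable y hyf).2.continuousAt
  have hDy : ∀ s : ℕ → X, (∀ n, s n ∈ domSubdiff f) → Tendsto s atTop (𝓝 y) →
      Tendsto (fun n => bregman f y (s n)) atTop (𝓝 0) := by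
    intro s hs hsy
    have h1 : Tendsto (fun n => grad f (s n)) atTop (𝓝 (grad f y)) :=
      (hf_cont y hyf).tendsto.comp (tendsto_nhdsWithin_iff.2 ⟨hsy, Eventually.of_forall hs⟩)
    have h2 := ((hcf.tendsto.comp hsy).const_sub (f y).toReal).sub
      (tendsto_dual_apply h1 (hsy.const_sub y))
    simpa [bregman] using h2
  have hΦφ : Tendsto (fun j => Φ y (φ j + 1)) atTop (𝓝 0) := by
    have h1 := (hDy _ (fun j => (hxm (φ j + 1 + 1)).2) (hshift 1)).add
      ((hDy _ (fun j => (hxm (φ j + 1)).2) hy0).const_mul (c * (1 - p)))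
    simpa using h1
  have hΦy : Tendsto (fun n => Φ y (n + 1)) atTop (𝓝 0) := by
    rw [Metric.tendsto_atTop]
    intro ε hε
    have hnear : ∀ᶠ u in 𝓝 y, |(f y).toReal - (f u).toReal| < ε / 16 ∧
        (|B| + 1) * ‖y - u‖ < ε / 16 := by
      have h1 : ContinuousAt (fun u => |(f y).toReal - (f u).toReal|) y :=
        (continuousAt_const.sub hcf).abs
      have h2 : ContinuousAt (fun u => (|B| + 1) * ‖y - u‖) y := by fun_prop
      exact (h1.eventually_lt continuousAt_const (by simpa using by positivity)).and
        (h2.eventually_lt continuousAt_const (by simpa using by positivity))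
    obtain ⟨u, huC, hu1, hu2⟩ :
        ∃ u ∈ C, |(f y).toReal - (f u).toReal| < ε / 16 ∧ (|B| + 1) * ‖y - u‖ < ε / 16 := by
      obtain ⟨u, h1, h2⟩ := (mem_closure_iff_frequently.1 (hCd ⟨hyS, hyf⟩)).and_eventually
        hnear |>.exists
      exact ⟨u, h1, h2⟩
    have hdiff : ∀ n, |bregman f y (x (n + 1)) - bregman f u (x (n + 1))| ≤ ε / 8 := by
      intro n
      have h1 : bregman f y (x (n + 1)) - bregman f u (x (n + 1)) =
          ((f y).toReal - (f u).toReal) - grad f (x (n + 1)) (y - u) := by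
        unfold bregman
        simp only [map_sub]
        ring
      have h2 : |grad f (x (n + 1)) (y - u)| ≤ (|B| + 1) * ‖y - u‖ :=
        ((grad f (x (n + 1))).le_opNorm _).trans
          (mul_le_mul_of_nonneg_right (by linarith [hB n, le_abs_self B]) (norm_nonneg _))
      rw [h1]
      exact (abs_sub _ _).trans (by linarith)
    have hΦdiff : ∀ n, |Φ y (n + 1) - Φ u (n + 1)| ≤ ε / 4 := by
      intro n
      have h1 := abs_le.1 (hdiff n)
      have h2 := abs_le.1 (hdiff (n + 1))
      simp only [Φ]
      rw [abs_le]
      constructor <;> nlinarith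
    obtain ⟨l, hl⟩ := hΦlim u huC
    have hl1 : |l| ≤ ε / 4 := by
      have h1 : Tendsto (fun j => |Φ y (φ j + 1) - Φ u (φ j + 1)|) atTop (𝓝 |0 - l|) :=
        (hΦφ.sub (hl.comp hφ1)).abs
      have h2 := le_of_tendsto h1 (Eventually.of_forall fun j => hΦdiff (φ j))
      simpa using h2
    obtain ⟨N, hN⟩ := Metric.tendsto_atTop.1 hl (ε / 4) (by positivity)
    refine ⟨N, fun n hn => ?_⟩
    have h1 := hN (n + 1) (by omega)
    have h2 := hΦdiff n
    rw [Real.dist_eq] at h1 ⊢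
    rw [sub_zero]
    have h3 : Φ y (n + 1) = (Φ y (n + 1) - Φ u (n + 1)) + (Φ u (n + 1) - l) + l := by ring
    rw [h3]
    refine (abs_add_three _ _ _).trans_lt ?_
    linarith
  refine (tendsto_add_atTop_iff_nat 2).1 (tendsto_iff_norm_sub_tendsto_zero.2 ?_)
  have hsq : Tendsto (fun n => ‖x (n + 2) - y‖ ^ 2) atTop (𝓝 0) := by
    refine squeeze_zero (fun n => sq_nonneg _) (fun n => ?_) (by simpa using hΦy.const_mul 2)
    have h1 := hf.half_sq_le_bregman hyf.1 (hxm (n + 2)).2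
    have h2 := mul_nonneg hcp0 (hD0 y hyf.1 (n + 1))
    rw [norm_sub_rev]
    simp only [Φ]
    linarith
  simpa using hsq.sqrt

end Limit

end BregmanVI

open BregmanVI
theorem mainTheorem1
    {X : Type*} [NormedAddCommGroup X] [NormedSpace ℝ X] [FiniteDimensional ℝ X]
    {Ω : Type*} {m : MeasurableSpace Ω} (μ : Measure Ω) [IsProbabilityMeasure μ]
    (ℱ : Filtration ℕ m)
    {M b : ℕ} (hb : 1 ≤ b) (hbM : b ≤ M)
    (K : Set X) (hK_nonempty : K.Nonempty) (hK_closed : IsClosed K) (hK_convex : Convex ℝ K)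
    (g : X → EReal) (hg : IsProperConvexLSC K g)
    (f : X → EReal) (hf : IsDistanceGenerating (effDomain K g) f)
    (hf_cont : ContinuousOn (grad f) (domSubdiff f))
    (F : X → StrongDual ℝ X)
    (Fξ : Fin M → X → StrongDual ℝ X) (Q : X → X → PMF (Fin M)) (L Lbar : ℝ)
    (hL : 0 ≤ L) (hLbar : 0 ≤ Lbar)
    (hS : (solutionSet K g F ∩ domSubdiff f).Nonempty)
    (hF_mono : IsMonotoneOn (effDomain K g) F)
    (h_oracle : IsVariableLipschitzOracle (effDomain K g) F Fξ Q Lbar)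
    (hF_lip : IsLipschitzOn (effDomain K g) F L)
    (hFξ_cont : ∀ i, ContinuousOn (Fξ i) (effDomain K g))
    (p γ α : ℝ) (hp0 : 0 < p) (hp1 : p < 1)
    (hγp : p < γ) (hγ : γ < 1 - Lbar ^ 2 * (1 - p))
    (hα0 : 0 < α) (hα1 : α ≤ (γ - p) / (1 - p))
    (hα2 : α * (L ^ 2 * (1 - p)) ≤ 1 - γ)
    (hα3 : α * (Lbar ^ 2 * (1 - p)) < 1 - γ)
    (x₀ : X) (hx₀ : x₀ ∈ effDomain K g ∩ domSubdiff f)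
    (ξ : ℕ → Fin b → Ω → Fin M) (coin : ℕ → Ω → Bool) (x w : ℕ → Ω → X)
    (h_run : IsAlgorithmRun μ ℱ K g f F Fξ Q p γ α x₀ ξ coin x w) :
    ∀ᵐ ω ∂μ, ∃ xt ∈ solutionSet K g F, Tendsto (fun s => x s ω) atTop (𝓝 xt) := by
  have hq : 0 < 1 - p := sub_pos.2 hp1
  set c := (1 - γ) / (1 - p) with hc
  have hγc : γ = 1 - c * (1 - p) := by rw [hc, div_mul_cancel₀ _ hq.ne']; ring
  have hc0 : 0 < c := div_pos (by nlinarith [mul_nonneg (sq_nonneg Lbar) hq.le]) hq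
  have hLc : Lbar ^ 2 < c := by rw [hc, lt_div_iff₀ hq]; linarith
  have hαc : α ≤ 1 - c := by
    refine hα1.trans_eq ?_
    rw [hc]
    field_simp
    ring
  have hc1 : c < 1 := by linarith
  have : ProperSpace X := FiniteDimensional.proper ℝ X
  obtain ⟨C, hCS, hC_count, hC_dense⟩ :=
    TopologicalSpace.IsSeparable.of_separableSpace (solutionSet K g F ∩ domSubdiff f)
      |>.exists_countable_dense_subset
  have hCne : C.Nonempty := closure_nonempty_iff.1 (hS.mono hC_dense)
  have hae : ∀ᵐ ω ∂μ, ∀ u ∈ C,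
      (∃ l, Tendsto (fun n => lyapunov f F u α p c (x (n + 1) ω) (x n ω) (w n ω)) atTop (𝓝 l)) ∧
      Tendsto (fun n => x (n + 2) ω - x (n + 1) ω) atTop (𝓝 0) ∧
      Tendsto (fun n => batchDiff Fξ (fun j => ξ (n + 1) j ω) (x (n + 1) ω) (w n ω))
        atTop (𝓝 0) :=
    (ae_ball_iff hC_count).2 fun u hu => h_run.ae_tendsto_lyapunov hb hg hf hF_mono h_oracle hα0
      hαc hc0 hLc hp0 hp1 hγc hx₀ (hCS hu).1
  filter_upwards [hae] with ω hω
  obtain ⟨u₀, hu₀⟩ := hCne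
  refine exists_tendsto_of_tendsto_lyapunov hK_closed hg hf hf_cont hF_lip hL hα0 hc0 hc1 hp0 hp1
    (w := fun n => w n ω) (h_run.x_mem hb hg hf hα0 hx₀ · ω)
    (fun n => (h_run.w_mem hb hg hf hα0 hx₀ n ω).1) (fun n => ?_) (fun n => ?_) (hω u₀ hu₀).2.1
    (hω u₀ hu₀).2.2 hCS ⟨u₀, hu₀⟩ hC_dense fun u hu => (hω u hu).1
  · rw [h_run.w_succ]
    split_ifs
    · exact Or.inl rfl
    · exact Or.inr rfl
  · have := h_run.isStep hb hg hf hα0 hx₀ (n + 1) ω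
    rwa [hγc] at this
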